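/- **Ordinary Lebesgue measure.** Group the coordinates of $\mathbb R^\infty=\mathbb R^{\mathbb N}$ (product topology), written $(a_0/2,a_1,b_1,a_2,b_2,\dots)$, into the consecutive blocks $(a_0/2),(a_1,b_1),(a_2,b_2),\dots$ of sizes $1,2,2,\dots$. An ordinary rectangle is a product $R=\prod_{k\ge0}R_k$ of Borel sets $R_k$ in the blocks whose Lebesgue volumes $|R_k|\in[0,\infty]$ have a finite ordinary product $\operatorname{vol}(R)=\lim_{n}\prod_{k<n}|R_k|$ (with $0\cdot\infty=0$). Let $\mu=\mu_{(1,2,2,\dots)}$ be the ordinary $(1,2,2,\dots)$-Lebesgue measure, $\mu(X)=\inf\{\sum_j\operatorname{vol}(R^j): X\subseteq\bigcup_jR^j\}$ for Borel $X$, the infimum being over countable covers by ordinary rectangles ($\mu(X)=\infty$ if there is none). It is a translation-invariant Borel measure with $\mu(R)=\operatorname{vol}(R)$ for every ordinary rectangle $R$. **The flow.** Let $l\ne0$ be real and let $\mathcal F$ be the linear operator on $\mathbb R^\infty$ that maps the coordinate $a_0/2$ to $0$ and each pair $(a_k,b_k)$, $k\ge1$, to $\left(\frac{k\pi}{l}b_k,-\frac{k\pi}{l}a_k\right)$.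 Let $(A_n)_{n\ge0}$ be real numbers for which the series $$\sigma_k=\sum_{n\ge0}(-1)^nA_{2n}\Big(\frac{k\pi}{l}\Big)^{2n},\qquad \omega_k=\sum_{n\ge0}(-1)^nA_{2n+1}\Big(\frac{k\pi}{l}\Big)^{2n+1}$$ converge for every $k\ge1$. Let $\Phi_t=\exp\big(t\sum_{n\ge0}A_n\mathcal F^n\big)$, $t\in\mathbb R$ (series taken coordinatewise), be the flow on $\mathbb R^\infty$ generated by the equation $\frac{d}{dt}a=\big(\sum_{n\ge0}A_n\mathcal F^n\big)a$. The flow is called *stable* if $\mu(\Phi_t(D))=\mu(D)$ for all $t>0$; *expansible* (resp. *pressing*) if $\mu(\Phi_{t_1}(D))<\mu(\Phi_{t_2}(D))$ (resp. $>$) whenever $0<t_1<t_2$; *totally expansible* (resp. *totally pressing*) if $\mu(\Phi_t(D))=\infty$ (resp. $=0$) for all $t>0$; in each case for all Borel $D$ with $0<\mu(D)<\infty$. **Satisfaction problem of consumers demands (SPCD).** Let $n\ge1$, $t_1<\dots<t_n$, $m_1,\dots,m_n>0$, and let $\tau$ be any choice operator, i.e. $\tau(\mathcal G)\in\mathcal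 G$ for every nonempty family $\mathcal G$ of subsets of $\mathbb R^\infty$. From a Borel set $Y$ with $\mu(Y)>0$ (an initial system) put $Z_1=\Phi_{t_1}(Y)$, $C_k=\tau\{X\subseteq Z_k\text{ Borel}:\mu(X)=m_k\}$ and $Z_{k+1}=\Phi_{t_{k+1}-t_k}(Z_k\setminus C_k)$. The demands are satisfied from $Y$ if for every $k=1,\dots,n$ the family from which $C_k$ is chosen is nonempty. A real number $m$ is a solution of SPCD if it is the minimum of $\mu(Y)$ over all initial systems $Y$ from which the demands are satisfied. **Claim.** Put $S_N=A_0+2\sum_{k=1}^N\sigma_k$. 1. If $S_N$ converges to a real number $S=A_0+2\sum_{k\ge1}\sigma_k$, then $$m=\sum_{k=1}^n m_k\,e^{-t_k\left(A_0+2\sum_{i\ge1}\sigma_i\right)}$$ is a solution of SPCD, and the demands are satisfied from every Borel set $Y$ with $\mu(Y)=m$. 2. If the flow is stable, expansible or pressing, then SPCD has a solution. 3. Suppose that $t_1>0$. If the flow is totally pressing or totally expansible, or if $S_N\to-\infty$ or $S_N\to+\infty$, then SPCD has no solution. -/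

import Mathlib

open Filter Topology MeasureTheory Set
open scoped ENNReal

/-! ## Ordinary `α`-Lebesgue measures on `ℝ^∞` (real sequences with the product topology) -/

/-- The index of the first coordinate of the `k`-th block, for blocks of sizes `α 0, α 1, …`. -/
def blockStart (α : ℕ → ℕ+) (k : ℕ) : ℕ := ∑ j ∈ Finset.range k, (α j : ℕ)

/-- The `k`-th block of coordinates of a sequence. -/
def block (α : ℕ → ℕ+) (k : ℕ) (x : ℕ → ℝ) : Fin (α k) → ℝ :=
  fun j => x (blockStart α k + j)

/-- The infinite-dimensional `α`-rectangle `∏ₖ Rₖ` in `ℝ^∞`. -/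
def rectangle (α : ℕ → ℕ+) (R : (k : ℕ) → Set (Fin (α k) → ℝ)) : Set (ℕ → ℝ) :=
  {x | ∀ k, block α k x ∈ R k}

/-- `β` is the ordinary product of the sequence `b`: the limit of its partial products. -/
def IsOrdinaryProduct (b : ℕ → ℝ≥0∞) (β : ℝ≥0∞) : Prop :=
  Tendsto (fun n => ∏ k ∈ Finset.range n, b k) atTop (𝓝 β)

/-- `∏ₖ Rₖ` is a measurable `α`-rectangle whose block volumes have the finite ordinary
product `β`. -/
def IsOrdinaryRectangle (α : ℕ → ℕ+) (R : (k : ℕ) → Set (Fin (α k) → ℝ)) (β : ℝ≥0∞) : Prop :=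
  (∀ k, MeasurableSet (R k)) ∧ β ≠ ∞ ∧ IsOrdinaryProduct (fun k => volume (R k)) β

/-- The volume of a set that is an ordinary `α`-rectangle, and `∞` for all other sets. -/
noncomputable def rectangleVolume (α : ℕ → ℕ+) (X : Set (ℕ → ℝ)) : ℝ≥0∞ :=
  ⨅ (R : (k : ℕ) → Set (Fin (α k) → ℝ)) (β : ℝ≥0∞)
    (_ : IsOrdinaryRectangle α R β ∧ X = rectangle α R), β

theorem rectangleVolume_le {α : ℕ → ℕ+} {R : (k : ℕ) → Set (Fin (α k) → ℝ)} {β : ℝ≥0∞}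
    (h : IsOrdinaryRectangle α R β) : rectangleVolume α (rectangle α R) ≤ β :=
  iInf_le_of_le R (iInf_le_of_le β (iInf_le_of_le ⟨h, rfl⟩ le_rfl))

theorem rectangleVolume_empty (α : ℕ → ℕ+) : rectangleVolume α ∅ = 0 := by
  have h : IsOrdinaryRectangle α (fun _ => ∅) 0 := by
    refine ⟨fun _ => MeasurableSet.empty, by simp, ?_⟩
    refine tendsto_const_nhds.congr' ?_
    filter_upwards [eventually_gt_atTop 0] with n hn
    have : n ≠ 0 := by omega
    simp [this]
  have e : rectangle α (fun _ => ∅) = ∅ := by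
    ext x; simp [rectangle]
  have := rectangleVolume_le h
  rw [e] at this
  exact le_antisymm this bot_le

/-- The outer measure whose value at `X` is the infimum of the sums `∑ⱼ vol(Rⱼ)` over all
countable covers of `X` by ordinary `α`-rectangles (and `∞` when there is no such cover). -/
noncomputable def ordinaryLebesgueOuter (α : ℕ → ℕ+) : OuterMeasure (ℕ → ℝ) :=
  OuterMeasure.ofFunction (rectangleVolume α) (rectangleVolume_empty α)

theorem exists_block_index (α : ℕ → ℕ+) (i : ℕ) :
    ∃ (k : ℕ) (j : Fin (α k)), blockStart α k + j = i := by
  induction i with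
  | zero => exact ⟨0, ⟨0, (α 0).pos⟩, by simp [blockStart]⟩
  | succ i ih =>
    obtain ⟨k, j, hj⟩ := ih
    by_cases h : (j : ℕ) + 1 < α k
    · exact ⟨k, ⟨j + 1, h⟩, by simp only; omega⟩
    · refine ⟨k + 1, ⟨0, (α (k + 1)).pos⟩, ?_⟩
      have := j.2
      simp only [blockStart, Finset.sum_range_succ] at hj ⊢
      omega

theorem isOrdinaryRectangle_split {α : ℕ → ℕ+} {R : (k : ℕ) → Set (Fin (α k) → ℝ)} {β : ℝ≥0∞}
    (h : IsOrdinaryRectangle α R β) (k : ℕ) {s : Set (Fin (α k) → ℝ)} (hs : MeasurableSet s) :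
    ∃ β₁ β₂, IsOrdinaryRectangle α (Function.update R k (R k ∩ s)) β₁ ∧
      IsOrdinaryRectangle α (Function.update R k (R k \ s)) β₂ ∧ β₁ + β₂ ≤ β := by
  obtain ⟨hm, hβ, hp⟩ := h
  set c : ℕ → ℝ≥0∞ := fun n => ∏ i ∈ (Finset.range n).erase k, volume (R i) with hc
  have hmeas : ∀ u, MeasurableSet u → ∀ i, MeasurableSet (Function.update R k u i) := by
    intro u hu i
    by_cases hi : i = k
    · subst hi; simpa using hu
    · simpa [Function.update_of_ne hi] using hm i
  have hprod : ∀ u, ∀ᶠ n in atTop,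
      volume u * c n = ∏ i ∈ Finset.range n, volume (Function.update R k u i) := by
    intro u
    filter_upwards [eventually_gt_atTop k] with n hn
    rw [← Finset.mul_prod_erase _ _ (Finset.mem_range.2 hn)]
    simp only [Function.update_self, hc]
    congr 1
    refine Finset.prod_congr rfl fun i hi => ?_
    rw [Function.update_of_ne (Finset.ne_of_mem_erase hi)]
  have hpc : Tendsto (fun n => volume (R k) * c n) atTop (𝓝 β) := by
    refine Tendsto.congr' ?_ hp
    filter_upwards [hprod (R k)] with n hn
    rw [hn, Function.update_eq_self]
  have hV : volume (R k ∩ s) + volume (R k \ s) = volume (R k) :=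
    measure_inter_add_sdiff _ hs
  suffices H : ∃ γ : ℝ≥0∞ → ℝ≥0∞,
      (∀ v, v ≤ volume (R k) → Tendsto (fun n => v * c n) atTop (𝓝 (γ v)) ∧ γ v ≠ ∞) ∧
      γ (volume (R k ∩ s)) + γ (volume (R k \ s)) ≤ β by
    obtain ⟨γ, h1, h2⟩ := H
    obtain ⟨ha, ha'⟩ := h1 _ (measure_mono inter_subset_left)
    obtain ⟨hb, hb'⟩ := h1 (volume (R k \ s)) (measure_mono sdiff_subset)
    exact ⟨_, _, ⟨hmeas _ ((hm k).inter hs), ha', ha.congr' (hprod _)⟩,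
      ⟨hmeas _ ((hm k).diff hs), hb', hb.congr' (hprod _)⟩, h2⟩
  by_cases h0 : volume (R k) = 0
  · refine ⟨fun _ => 0, fun v hv => ?_, by simp⟩
    have : v = 0 := le_antisymm (hv.trans h0.le) bot_le
    subst this
    simp
  by_cases ht : volume (R k) = ∞
  · refine ⟨fun _ => 0, fun v hv => ⟨?_, by simp⟩, by simp⟩
    refine tendsto_const_nhds.congr' ?_
    filter_upwards [hpc.eventually (gt_mem_nhds (lt_top_iff_ne_top.2 hβ))] with n hn
    have : c n = 0 := by
      by_contra hne
      rw [ht, ENNReal.top_mul hne] at hn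
      exact lt_irrefl _ hn
    simp [this]
  · refine ⟨fun v => v * ((volume (R k))⁻¹ * β), fun v hv => ?_, ?_⟩
    · have hvt : v ≠ ∞ := ne_top_of_le_ne_top ht hv
      have hi : (volume (R k))⁻¹ ≠ ∞ := ENNReal.inv_ne_top.2 h0
      refine ⟨?_, ENNReal.mul_ne_top hvt (ENNReal.mul_ne_top hi hβ)⟩
      have h1 := ENNReal.Tendsto.const_mul (a := (volume (R k))⁻¹) hpc (Or.inr hi)
      have h2 : Tendsto c atTop (𝓝 ((volume (R k))⁻¹ * β)) := by
        refine h1.congr fun n => ?_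
        rw [← mul_assoc, ENNReal.inv_mul_cancel h0 ht, one_mul]
      exact ENNReal.Tendsto.const_mul h2 (Or.inr hvt)
    · rw [← add_mul, hV, ← mul_assoc, ENNReal.mul_inv_cancel h0 ht, one_mul]

theorem borel_le_caratheodory (α : ℕ → ℕ+) :
    (MeasurableSpace.pi : MeasurableSpace (ℕ → ℝ)) ≤ (ordinaryLebesgueOuter α).caratheodory := by
  refine iSup_le fun i => ?_
  rintro _ ⟨s, hs, rfl⟩
  obtain ⟨k, j, rfl⟩ := exists_block_index α i
  refine OuterMeasure.ofFunction_caratheodory fun X => ?_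
  refine le_iInf fun R => le_iInf fun β => le_iInf fun h => ?_
  obtain ⟨h, rfl⟩ := h
  have hs' : MeasurableSet {y : Fin (α k) → ℝ | y j ∈ s} := measurable_pi_apply j hs
  obtain ⟨β₁, β₂, h₁, h₂, hle⟩ := isOrdinaryRectangle_split h k hs'
  have e : ∀ (u v : Set (Fin (α k) → ℝ)) (w : Set (ℕ → ℝ)), u = R k ∩ v →
      (∀ x, x ∈ w ↔ block α k x ∈ v) →
      rectangle α R ∩ w = rectangle α (Function.update R k u) := by
    intro u v w hu hw
    ext x
    constructor
    · rintro ⟨hx, hxw⟩ i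
      by_cases hi : i = k
      · subst hi
        simpa [hu] using ⟨hx i, (hw x).1 hxw⟩
      · simpa [Function.update_of_ne hi] using hx i
    · intro hx
      have hk : block α k x ∈ R k ∩ v := by simpa [hu] using hx k
      refine ⟨fun i => ?_, (hw x).2 hk.2⟩
      by_cases hi : i = k
      · subst hi; exact hk.1
      · simpa [Function.update_of_ne hi] using hx i
  have e₁ := e _ {y | y j ∈ s} ((fun x : ℕ → ℝ => x (blockStart α k + j)) ⁻¹' s) rfl
    fun x => Iff.rfl
  have e₂ := e (R k \ {y | y j ∈ s}) {y | y j ∈ s}ᶜ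
    ((fun x : ℕ → ℝ => x (blockStart α k + j)) ⁻¹' s)ᶜ (sdiff_eq _ _) fun x => Iff.rfl
  rw [← sdiff_eq] at e₂
  rw [e₁, e₂]
  exact (add_le_add (rectangleVolume_le h₁) (rectangleVolume_le h₂)).trans hle

/-- The ordinary `α`-Lebesgue measure `μ_α` on the Borel sets of `ℝ^∞`. -/
noncomputable def ordinaryLebesgue (α : ℕ → ℕ+) : Measure (ℕ → ℝ) :=
  (ordinaryLebesgueOuter α).toMeasure (borel_le_caratheodory α)

/-- `μ` is translation-invariant and gives every ordinary `α`-rectangle its volume, that is, `μ`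
is (the restriction to the Borel sets of) an ordinary `α`-Lebesgue measure. -/
def IsOrdinaryLebesgueMeasure (α : ℕ → ℕ+) (μ : Measure (ℕ → ℝ)) : Prop :=
  (∀ (v : ℕ → ℝ) (B : Set (ℕ → ℝ)), MeasurableSet B → μ ((fun x => v + x) '' B) = μ B) ∧
  ∀ (R : (k : ℕ) → Set (Fin (α k) → ℝ)) (β : ℝ≥0∞), IsOrdinaryRectangle α R β →
    μ (rectangle α R) = β

theorem measurable_block (α : ℕ → ℕ+) (k : ℕ) : Measurable (block α k) :=
  measurable_pi_lambda _ fun _ => measurable_pi_apply _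

theorem measurableSet_rectangle {α : ℕ → ℕ+} {R : (k : ℕ) → Set (Fin (α k) → ℝ)}
    (h : ∀ k, MeasurableSet (R k)) : MeasurableSet (rectangle α R) := by
  have : rectangle α R = ⋂ k, block α k ⁻¹' R k := by
    ext x; simp [rectangle]
  rw [this]
  exact MeasurableSet.iInter fun k => measurable_block α k (h k)

theorem ordinaryLebesgueOuter_translate_le (α : ℕ → ℕ+) (v : ℕ → ℝ) (X : Set (ℕ → ℝ)) :
    ordinaryLebesgueOuter α ((fun x => v + x) '' X) ≤ ordinaryLebesgueOuter α X := by
  have key : OuterMeasure.comap (fun x => v + x) (ordinaryLebesgueOuter α) ≤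
      ordinaryLebesgueOuter α := by
    refine OuterMeasure.le_ofFunction.2 fun s => ?_
    refine le_iInf fun R => le_iInf fun β => le_iInf fun h => ?_
    obtain ⟨h, rfl⟩ := h
    rw [OuterMeasure.comap_apply]
    have e : (fun x => v + x) '' rectangle α R =
        rectangle α (fun k => (fun y => -block α k v + y) ⁻¹' R k) := by
      ext x
      constructor
      · rintro ⟨y, hy, rfl⟩ k
        have : -block α k v + block α k (v + y) = block α k y := by
          ext j; simp [block]
        simpa [this] using hy k
      · intro hx
        refine ⟨-v + x, fun k => ?_, by simp⟩
        exact hx k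
    rw [e]
    refine (OuterMeasure.ofFunction_le _).trans (rectangleVolume_le ⟨fun k => ?_, h.2.1, ?_⟩)
    · exact (measurable_const_add _) (h.1 k)
    · simpa [IsOrdinaryProduct, measure_preimage_add] using h.2.2
  exact key X

theorem exists_blocks (α : ℕ → ℕ+) (y : (k : ℕ) → Fin (α k) → ℝ) :
    ∃ x : ℕ → ℝ, ∀ k, block α k x = y k := by
  choose K J hKJ using exists_block_index α
  refine ⟨fun i => y (K i) (J i), fun k => ?_⟩
  ext j
  simp only [block]
  have mono : Monotone (blockStart α) := by
    refine monotone_nat_of_le_succ fun n => ?_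
    simp [blockStart, Finset.sum_range_succ]
  have hlt : ∀ a b : ℕ, ∀ (p : Fin (α a)) (q : Fin (α b)),
      blockStart α a + p = blockStart α b + q → b ≤ a := by
    intro a b p q h
    by_contra hab
    have h1 : blockStart α (a + 1) ≤ blockStart α b := mono (by omega)
    have h2 := p.2
    simp only [blockStart, Finset.sum_range_succ] at h h1
    omega
  have h := hKJ (blockStart α k + j)
  have hk : K (blockStart α k + j) = k :=
    le_antisymm (hlt _ _ _ _ h.symm) (hlt _ _ _ _ h)
  generalize J (blockStart α k + j) = q at h
  revert q
  rw [hk]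
  intro q h
  have : q = j := Fin.ext (by omega)
  rw [this]

theorem le_ordinaryLebesgueOuter {α : ℕ → ℕ+} {R : (k : ℕ) → Set (Fin (α k) → ℝ)} {β : ℝ≥0∞}
    (h : IsOrdinaryRectangle α R β) : β ≤ ordinaryLebesgueOuter α (rectangle α R) := by
  by_cases hβ0 : β = 0
  · simp [hβ0]
  obtain ⟨hm, hβ, hp⟩ := h
  have h0 : ∀ k, volume (R k) ≠ 0 := by
    intro k hk
    refine hβ0 (tendsto_nhds_unique hp (tendsto_const_nhds.congr' ?_))
    filter_upwards [eventually_gt_atTop k] with n hn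
    exact (Finset.prod_eq_zero (Finset.mem_range.2 hn) hk).symm
  have ht : ∀ k, volume (R k) ≠ ∞ := by
    intro k hk
    obtain ⟨n, hn, hn'⟩ := ((hp.eventually (gt_mem_nhds (lt_top_iff_ne_top.2 hβ))).and
      (eventually_gt_atTop k)).exists
    rw [← Finset.mul_prod_erase _ _ (Finset.mem_range.2 hn'), hk,
      ENNReal.top_mul (Finset.prod_ne_zero_iff.2 fun i _ => h0 i)] at hn
    exact lt_irrefl _ hn
  have hprob : ∀ k, IsProbabilityMeasure (ProbabilityTheory.cond volume (R k)) := fun k =>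
    ProbabilityTheory.cond_isProbabilityMeasure_of_finite (h0 k) (ht k)
  set P := Measure.infinitePi fun k => ProbabilityTheory.cond volume (R k) with hP
  have hcyl : ∀ (Q : (k : ℕ) → Set (Fin (α k) → ℝ)), (∀ k, MeasurableSet (Q k)) → ∀ n,
      P (Set.pi (Finset.range n) Q) =
        ∏ k ∈ Finset.range n, ProbabilityTheory.cond volume (R k) (Q k) := by
    intro Q hQ n
    exact Measure.infinitePi_pi _ fun k _ => hQ k
  have hR : P (Set.pi univ R) = 1 := by
    have e : ∀ᵐ y ∂P, ∀ k, y k ∈ R k := by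
      refine ae_all_iff.2 fun k => ?_
      have h1 : P (Set.pi (({k} : Finset ℕ) : Set ℕ) R) = 1 := by
        rw [hP, Measure.infinitePi_pi _ fun k _ => hm k]
        simp [ProbabilityTheory.cond_apply (hm k), ENNReal.inv_mul_cancel (h0 k) (ht k)]
      have h2 := (prob_compl_eq_zero_iff
        (MeasurableSet.pi (Finset.countable_toSet _) fun i _ => hm i)).2 h1
      rw [ae_iff]
      convert h2 using 2
      ext y
      simp
    have h3 := prob_compl_eq_zero_iff (μ := P)
      (MeasurableSet.univ_pi fun i => hm i)
    refine h3.1 ?_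
    rw [ae_iff] at e
    convert e using 2
    ext y
    simp
  have hQ : ∀ (Q : (k : ℕ) → Set (Fin (α k) → ℝ)) (γ : ℝ≥0∞), IsOrdinaryRectangle α Q γ →
      P (Set.pi univ Q) ≤ β⁻¹ * γ := by
    rintro Q γ ⟨hQm, hγ, hQp⟩
    have hlim : Tendsto (fun n => (∏ k ∈ Finset.range n, volume (R k))⁻¹ *
        ∏ k ∈ Finset.range n, volume (Q k)) atTop (𝓝 (β⁻¹ * γ)) :=
      ENNReal.Tendsto.mul (tendsto_inv_iff.2 hp) (Or.inr hγ) hQp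
        (Or.inr (ENNReal.inv_ne_top.2 hβ0))
    refine ge_of_tendsto hlim (Eventually.of_forall fun n => ?_)
    calc P (Set.pi univ Q) ≤ P (Set.pi (Finset.range n) Q) :=
          measure_mono (Set.pi_mono' (fun _ _ => le_rfl) (subset_univ _))
      _ = ∏ k ∈ Finset.range n, ProbabilityTheory.cond volume (R k) (Q k) := hcyl Q hQm n
      _ ≤ ∏ k ∈ Finset.range n, ((volume (R k))⁻¹ * volume (Q k)) := by
          refine Finset.prod_le_prod' fun k _ => ?_
          rw [ProbabilityTheory.cond_apply (hm k)]
          gcongr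
          exact inter_subset_right
      _ = _ := by
          rw [Finset.prod_mul_distrib]
          congr 1
          exact (ENNReal.prod_inv_distrib fun i _ j _ _ => Or.inl (h0 i)).symm
  obtain ⟨f, hf⟩ : ∃ f : ((k : ℕ) → Fin (α k) → ℝ) → (ℕ → ℝ), ∀ y k, block α k (f y) = y k := by
    choose f hf using exists_blocks α
    exact ⟨f, hf⟩
  have hpre : ∀ Q, f ⁻¹' rectangle α Q = Set.pi univ Q := by
    intro Q; ext y; simp [rectangle, hf]
  have key : β • OuterMeasure.map f P.toOuterMeasure ≤ ordinaryLebesgueOuter α := by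
    refine OuterMeasure.le_ofFunction.2 fun s => ?_
    refine le_iInf fun Q => le_iInf fun γ => le_iInf fun h => ?_
    obtain ⟨h, rfl⟩ := h
    simp only [_root_.smul_apply, OuterMeasure.map_apply, hpre, smul_eq_mul,
      Measure.coe_toOuterMeasure]
    calc β * P (Set.pi univ Q) ≤ β * (β⁻¹ * γ) := by gcongr; exact hQ Q γ h
      _ = γ := by rw [← mul_assoc, ENNReal.mul_inv_cancel hβ0 hβ, one_mul]
  have := key (rectangle α R)
  simpa [hpre, hR] using this

theorem ordinaryLebesgue_isOrdinaryLebesgueMeasure (α : ℕ → ℕ+) :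
    IsOrdinaryLebesgueMeasure α (ordinaryLebesgue α) := by
  refine ⟨fun v B hB => ?_, fun R β h => ?_⟩
  · have hB' : MeasurableSet ((fun x => v + x) '' B) := by
      rw [Set.image_add_left]
      exact measurable_const_add _ hB
    rw [ordinaryLebesgue, toMeasure_apply _ _ hB, toMeasure_apply _ _ hB']
    refine le_antisymm (ordinaryLebesgueOuter_translate_le α v B) ?_
    have := ordinaryLebesgueOuter_translate_le α (-v) ((fun x => v + x) '' B)
    have e : (fun x => -v + x) '' ((fun x => v + x) '' B) = B := by
      rw [Set.image_image]
      simp only [neg_add_cancel_left, Set.image_id']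
    rwa [e] at this
  · rw [ordinaryLebesgue, toMeasure_apply _ _ (measurableSet_rectangle h.1)]
    exact le_antisymm ((OuterMeasure.ofFunction_le _).trans (rectangleVolume_le h))
      (le_ordinaryLebesgueOuter h)

/-- The block sizes `(1, 2, 2, …)`. -/
def oneTwoTwo : ℕ → ℕ+ := fun k => if k = 0 then 1 else 2

/-! ## The flow of the Fourier differential equation -/

/-- The Fourier differential operator on the coefficient sequences
`(a₀/2, a₁, b₁, a₂, b₂, …)`: it maps `(aₖ, bₖ)` to `((kπ/l) bₖ, -(kπ/l) aₖ)`, where `aₖ` is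
coordinate `2k-1` and `bₖ` is coordinate `2k`, and it maps coordinate `0` to `0`. -/
noncomputable def fourierDeriv (l : ℝ) : (ℕ → ℝ) →ₗ[ℝ] (ℕ → ℝ) where
  toFun a i :=
    if i = 0 then 0
    else if i % 2 = 1 then (((i + 1) / 2 : ℕ) : ℝ) * Real.pi / l * a (i + 1)
    else -(((i / 2 : ℕ) : ℝ) * Real.pi / l) * a (i - 1)
  map_add' a b := by
    ext i
    simp only [Pi.add_apply]
    split_ifs <;> ring
  map_smul' c a := by
    ext i
    simp only [Pi.smul_apply, smul_eq_mul, RingHom.id_apply]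
    split_ifs <;> ring

/-- The operator `∑ₙ Aₙ (𝓕 d/dx)ⁿ`, the series being summed coordinatewise. -/
noncomputable def fourierGenerator (l : ℝ) (A : ℕ → ℝ) (a : ℕ → ℝ) : ℕ → ℝ :=
  fun i => limUnder atTop
    (fun N : ℕ => ∑ n ∈ Finset.range N, A n * ((fourierDeriv l ^ n) a) i)

/-- The motion `Φ_t = exp(t ∑ₙ Aₙ (𝓕 d/dx)ⁿ)`, the exponential series being summed in the
product topology of `ℝ^∞`. -/
noncomputable def fourierFlow (l : ℝ) (A : ℕ → ℝ) (t : ℝ) (C : ℕ → ℝ) : ℕ → ℝ :=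
  ∑' p : ℕ, (t ^ p / (p.factorial : ℝ)) • (fourierGenerator l A)^[p] C

/-! ## Behaviour of a flow with respect to a measure -/

section Flows

variable {E : Type*} [MeasurableSpace E]

def IsStableFlow (ν : Measure E) (Φ : ℝ → E → E) : Prop :=
  ∀ t, 0 < t → ∀ D, MeasurableSet D → 0 < ν D → ν D < ∞ → ν (Φ t '' D) = ν D

def IsExpansibleFlow (ν : Measure E) (Φ : ℝ → E → E) : Prop :=
  ∀ t₁ t₂, 0 < t₁ → t₁ < t₂ → ∀ D, MeasurableSet D → 0 < ν D → ν D < ∞ →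
    ν (Φ t₁ '' D) < ν (Φ t₂ '' D)

def IsPressingFlow (ν : Measure E) (Φ : ℝ → E → E) : Prop :=
  ∀ t₁ t₂, 0 < t₁ → t₁ < t₂ → ∀ D, MeasurableSet D → 0 < ν D → ν D < ∞ →
    ν (Φ t₂ '' D) < ν (Φ t₁ '' D)

def IsTotallyExpansibleFlow (ν : Measure E) (Φ : ℝ → E → E) : Prop :=
  ∀ t, 0 < t → ∀ D, MeasurableSet D → 0 < ν D → ν D < ∞ → ν (Φ t '' D) = ∞

def IsTotallyPressingFlow (ν : Measure E) (Φ : ℝ → E → E) : Prop :=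
  ∀ t, 0 < t → ∀ D, MeasurableSet D → 0 < ν D → ν D < ∞ → ν (Φ t '' D) = 0

/-! ## The satisfaction problem of consumers demands -/

/-- `τ` picks a member of every nonempty family of sets. -/
def IsChoiceOperator (τ : Set (Set E) → Set E) : Prop :=
  ∀ F : Set (Set E), F.Nonempty → τ F ∈ F

/-- The Borel subsets of `Z` of measure `c`. -/
def demandFamily (ν : Measure E) (Z : Set E) (c : ℝ) : Set (Set E) :=
  {X | MeasurableSet X ∧ X ⊆ Z ∧ ν X = ENNReal.ofReal c}

/-- The set offered to consumer `k` (counted from `0`) when the initial system is `Y`, consumer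
`j` comes at time `t j` and takes the set chosen by `τ` among those of measure `m j`. -/
def offeredSet (τ : Set (Set E) → Set E) (ν : Measure E) (Φ : ℝ → E → E) (t m : ℕ → ℝ)
    (Y : Set E) : ℕ → Set E
  | 0 => Φ (t 0) '' Y
  | k + 1 => Φ (t (k + 1) - t k) ''
      (offeredSet τ ν Φ t m Y k \ τ (demandFamily ν (offeredSet τ ν Φ t m Y k) (m k)))

/-- The demands of the consumers `0, …, n - 1` are all satisfied from the initial system `Y`. -/
def DemandsSatisfied (τ : Set (Set E) → Set E) (ν : Measure E) (Φ : ℝ → E → E) (n : ℕ)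
    (t m : ℕ → ℝ) (Y : Set E) : Prop :=
  ∀ k < n, (demandFamily ν (offeredSet τ ν Φ t m Y k) (m k)).Nonempty

/-- The real number `M` solves the satisfaction problem: it is the least measure of an initial
system (a Borel set of positive measure) from which all demands are satisfied. -/
def IsSPCDSolution (τ : Set (Set E) → Set E) (ν : Measure E) (Φ : ℝ → E → E) (n : ℕ)
    (t m : ℕ → ℝ) (M : ℝ) : Prop :=
  IsLeast {v : ℝ≥0∞ | ∃ Y : Set E, MeasurableSet Y ∧ 0 < ν Y ∧
    DemandsSatisfied τ ν Φ n t m Y ∧ ν Y = v} (ENNReal.ofReal M)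

end Flows

/-! Written as a complex number, the `k`-th pair is multiplied by `-i k π / l` under the Fourier
operator, hence by `exp (t (σ k - i ω k))` under the flow. The flow therefore sends rectangles to
rectangles and scales the volume of block `k` by `exp (t ρ k)`, where `ρ 0 = A 0` and `ρ k = 2 σ k`.
The partial sums of `ρ` are the `S_N` of the claim, and everything that follows uses only this
scaling property, `IsBlockScaling`.

If `S_N` converges to `S`, ordinary rectangles go to ordinary rectangles, so the flow multiplies the
measure by `exp (t S)`. Carried back to time `0`, what remains and what has been consumed add up to
the measure of the initial system (`measure_offeredSet`). This gives the lower bound. It is attained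
because the measure is atomless on sets of finite measure: hyperplanes are null there, so every
smaller positive value is the measure of a subset. A stable, expansible or pressing flow keeps some
rectangle of volume `1` at positive finite measure, which forces `S_N` to converge.

Suppose now that `S_N` does not converge and `t 0 > 0`. If the first demand can be met from a set of
finite measure, then `exp (t 0 * S_N)` has a limit in `(0, ∞]` (`exists_tendsto_exp`), so `S_N →
+∞`. In that case null sets can serve as reservoirs (`exists_reservoir`). The image at time `T` of a
suitable null rectangle is a rectangle `W` whose partial volumes grow more slowly than `exp (T S_N)`
but, infinitely often, much faster than `exp ((T - c) S_N)`. Sets of finite measure removed at times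
at least `c` are then negligible for the uniform probability on `W`. That probability is an average
of uniform probabilities on translates of a rectangle of volume `m`, so some translate is almost
untouched and meets the demand. Adding such null sets to a rectangle of volume `ε` satisfies all
demands at cost `ε`, so no minimum exists.

The bridge between rectangles and arbitrary sets is the family of product probabilities `blockProd`:
normalised volume on a rectangle of positive volume `β`, multiplied by `β`, is dominated by the
ordinary Lebesgue measure. -/

/-! ### Atomless measures, convolutions of products, and tilings by boxes -/

/-- The law of `f` on `Z` has no atoms, so its distribution function is continuous and the
intermediate value theorem applies to the sublevel sets of `f`. -/
theorem exists_measurableSet_subset_measure_eq {E : Type*} [MeasurableSpace E] {ν : Measure E}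
    {Z : Set E} (hZ : MeasurableSet Z) (hfin : ν Z ≠ ∞) {f : E → ℝ} (hf : Measurable f)
    (hnull : ∀ c, ν (Z ∩ f ⁻¹' {c}) = 0) {c : ℝ≥0∞} (hc0 : c ≠ 0) (hc : c ≤ ν Z) :
    ∃ X, MeasurableSet X ∧ X ⊆ Z ∧ ν X = c := by
  -- The full mass is only a limit of the distribution function and may not be attained at a real
  -- argument, so this case is separate.
  rcases hc.eq_or_lt with rfl | hc
  · exact ⟨Z, hZ, Subset.rfl, rfl⟩
  set η : Measure ℝ := (ν.restrict Z).map f with hη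
  have hηa : ∀ s, MeasurableSet s → η s = ν (Z ∩ f ⁻¹' s) := fun s hs => by
    rw [hη, Measure.map_apply hf hs, Measure.restrict_apply (hf hs), inter_comm]
  have hηu : η univ = ν Z := by simp [hηa univ MeasurableSet.univ]
  have : IsFiniteMeasure η := ⟨by rw [hηu]; exact hfin.lt_top⟩
  have : NullSingletonClass η := ⟨fun x => by rw [hηa _ (measurableSet_singleton x), hnull]⟩
  have hct : c ≠ ∞ := hc.ne_top
  have hcont : Continuous fun x => η.real (Iic x) := by
    have h1 : ∀ x, η.real (Iic x) = η.real (Iic 0) + ∫ _ in (0 : ℝ)..x, (1 : ℝ) ∂η := by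
      intro x
      rw [← intervalIntegral.integral_Iic_sub_Iic (by simp) (by simp)]
      simp
    rw [funext h1]
    exact continuous_const.add (intervalIntegral.continuous_primitive
      (fun a b => intervalIntegrable_const) 0)
  have hlo : ∃ x, η.real (Iic x) ≤ c.toReal := by
    have : Tendsto (fun x => η (Iic x)) atBot (𝓝 0) := by
      have h : Tendsto (fun x : ℝ => η (Iic x)) atBot (𝓝 (η (⋂ x : ℝ, Iic x))) :=
        tendsto_measure_iInter_atBot (fun _ => measurableSet_Iic.nullMeasurableSet)
          (fun _ _ h => Iic_subset_Iic.2 h) ⟨0, measure_ne_top _ _⟩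
      have e : (⋂ x : ℝ, Iic x) = ∅ := by
        ext y; simpa using exists_lt y
      rwa [e, measure_empty] at h
    obtain ⟨x, hx⟩ := (this.eventually (gt_mem_nhds (pos_iff_ne_zero.2 hc0))).exists
    exact ⟨x, ENNReal.toReal_mono hct hx.le⟩
  have hhi : ∃ x, c.toReal ≤ η.real (Iic x) := by
    have := tendsto_measure_Iic_atTop η
    rw [hηu] at this
    obtain ⟨x, hx⟩ := (this.eventually (lt_mem_nhds hc)).exists
    exact ⟨x, ENNReal.toReal_mono (measure_ne_top _ _) hx.le⟩
  obtain ⟨x, hx⟩ := mem_range_of_exists_le_of_exists_ge hcont hlo hhi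
  refine ⟨Z ∩ f ⁻¹' Iic x, hZ.inter (hf measurableSet_Iic), inter_subset_left, ?_⟩
  rw [← hηa _ measurableSet_Iic]
  exact (ENNReal.toReal_eq_toReal_iff' (measure_ne_top _ _) hct).1 hx

/-- On cylinders, integrating over the first summand leaves a finite product of functions of
independent coordinates, whose integral factors. -/
theorem infinitePi_conv_infinitePi {X : ℕ → Type*} [∀ k, AddMonoid (X k)]
    [∀ k, MeasurableSpace (X k)] [∀ k, MeasurableAdd₂ (X k)] (p q : ∀ k, Measure (X k))
    [∀ k, IsProbabilityMeasure (p k)] [∀ k, IsProbabilityMeasure (q k)] :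
    (Measure.infinitePi p).conv (Measure.infinitePi q) =
      Measure.infinitePi fun k => (p k).conv (q k) := by
  have : ∀ k, IsProbabilityMeasure ((p k).conv (q k)) := fun k => by
    unfold Measure.conv
    exact Measure.isProbabilityMeasure_map (by fun_prop)
  refine Measure.eq_infinitePi _ fun s u hu => ?_
  have hpi : MeasurableSet (Set.pi (s : Set ℕ) u) :=
    MeasurableSet.pi s.countable_toSet fun i _ => hu i
  have hadd : ∀ k, Measurable fun x : X k × X k => x.1 + x.2 := fun k => measurable_add
  have hm : ∀ k, Measurable fun x => q k ((fun y => x + y) ⁻¹' u k) := fun k =>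
    measurable_measure_prodMk_left (hadd k (hu k))
  have hadd' : Measurable fun x : (∀ k, X k) × (∀ k, X k) => x.1 + x.2 :=
    measurable_pi_lambda _ fun k =>
      (hadd k).comp (((measurable_pi_apply k).comp measurable_fst).prodMk
        ((measurable_pi_apply k).comp measurable_snd))
  have h1 : ∀ k, (p k).conv (q k) (u k) = ∫⁻ x, q k ((fun y => x + y) ⁻¹' u k) ∂p k := by
    intro k
    rw [Measure.conv, Measure.map_apply (hadd k) (hu k), Measure.prod_apply (hadd k (hu k))]
    rfl
  rw [Measure.conv, Measure.map_apply hadd' hpi, Measure.prod_apply (hadd' hpi)]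
  have h2 : ∀ x : ∀ k, X k, Measure.infinitePi q
      (Prod.mk x ⁻¹' ((fun x : (∀ k, X k) × (∀ k, X k) => x.1 + x.2) ⁻¹' Set.pi s u)) =
      ∏ k ∈ s, q k ((fun y => x k + y) ⁻¹' u k) := by
    intro x
    have : Prod.mk x ⁻¹' ((fun x : (∀ k, X k) × (∀ k, X k) => x.1 + x.2) ⁻¹' Set.pi s u) =
        Set.pi s fun k => (fun y => x k + y) ⁻¹' u k := by
      ext y; simp [Set.mem_pi]
    rw [this, Measure.infinitePi_pi]
    exact fun k _ => (measurable_const_add (x k)) (hu k)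
  simp only [h2, h1]
  have hind := ProbabilityTheory.iIndepFun_infinitePi (P := p)
    (X := fun k x => q k ((fun y => x + y) ⁻¹' u k)) hm
  rw [ProbabilityTheory.lintegral_prod_eq_prod_lintegral_of_indepFun s _ hind
    fun k => (hm k).comp (measurable_pi_apply k)]
  refine Finset.prod_congr rfl fun k _ => ?_
  conv_rhs => rw [← Measure.infinitePi_map_eval p k, lintegral_map (hm k) (measurable_pi_apply k)]

theorem exists_box_volume {d : ℕ} (hd : 0 < d) {v : ℝ} (hv : 0 < v) :
    ∃ (B : Set (Fin d → ℝ)) (e : Fin d → ℝ), MeasurableSet B ∧ volume B = ENNReal.ofReal v ∧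
      Pairwise fun i j : ℕ => Disjoint ((fun x => -((i : ℝ) • e) + x) ⁻¹' B)
        ((fun x => -((j : ℝ) • e) + x) ⁻¹' B) := by
  classical
  set z : Fin d := ⟨0, hd⟩
  refine ⟨Set.pi univ fun j => Ico 0 (if j = z then v else 1), Pi.single z v,
    MeasurableSet.univ_pi fun j => measurableSet_Ico, ?_, ?_⟩
  · rw [volume_pi_pi, Finset.prod_eq_single z]
    · simp
    · intro j _ hj; simp [hj]
    · simp
  · have key : ∀ i j : ℕ, i < j → Disjoint
        ((fun x => -((i : ℝ) • (Pi.single z v : Fin d → ℝ)) + x) ⁻¹'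
          (Set.pi univ fun j => Ico 0 (if j = z then v else 1)))
        ((fun x => -((j : ℝ) • (Pi.single z v : Fin d → ℝ)) + x) ⁻¹'
          (Set.pi univ fun j => Ico 0 (if j = z then v else 1))) := by
      intro i j hij
      rw [Set.disjoint_left]
      intro x hi hj
      have h1 := hi z (mem_univ _)
      have h2 := hj z (mem_univ _)
      simp only [Pi.add_apply, Pi.neg_apply, Pi.smul_apply, Pi.single_eq_same, smul_eq_mul,
        if_true, mem_Ico] at h1 h2
      have h3 : (i : ℝ) + 1 ≤ j := by exact_mod_cast hij
      nlinarith [mul_le_mul_of_nonneg_right h3 hv.le]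
    intro i j hij
    rcases lt_or_gt_of_ne hij with h | h
    · exact key i j h
    · exact (key j i h).symm

/-- `W` is the disjoint union of `w` translates of the box `B`, and `p` is uniform on the
translation vectors: a uniform point of `W` is a uniform point of `B` shifted by an independent
random vector. -/
theorem exists_cell_decomposition {d : ℕ} (hd : 0 < d) {v : ℝ} (hv : 0 < v) {w : ℕ}
    (hw : 0 < w) :
    ∃ (B W : Set (Fin d → ℝ)) (p : Measure (Fin d → ℝ)), MeasurableSet B ∧ MeasurableSet W ∧
      volume B = ENNReal.ofReal v ∧ volume W = w * ENNReal.ofReal v ∧ IsProbabilityMeasure p ∧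
      p.conv (ProbabilityTheory.cond volume B) = ProbabilityTheory.cond volume W := by
  obtain ⟨B, e, hB, hBv, hdis⟩ := exists_box_volume hd hv
  have hT : ∀ i : ℕ, MeasurableSet ((fun x => -((i : ℝ) • e) + x) ⁻¹' B) := fun i =>
    (measurable_const_add _) hB
  have hw0 : (w : ℝ≥0∞) ≠ 0 := by exact_mod_cast hw.ne'
  have hwt : (w : ℝ≥0∞) ≠ ∞ := ENNReal.natCast_ne_top w
  have hv0 : ENNReal.ofReal v ≠ 0 := by simpa using hv
  set W : Set (Fin d → ℝ) := ⋃ i ∈ Finset.range w, (fun x => -((i : ℝ) • e) + x) ⁻¹' B with hW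
  have hWm : MeasurableSet W := Finset.measurableSet_biUnion _ fun i _ => hT i
  have hWs : ∀ s, MeasurableSet s → volume (W ∩ s) =
      ∑ i ∈ Finset.range w, volume (B ∩ (fun x => (i : ℝ) • e + x) ⁻¹' s) := by
    intro s hs
    rw [hW, iUnion₂_inter, measure_biUnion_finset]
    · refine Finset.sum_congr rfl fun i _ => ?_
      rw [← measure_preimage_add volume ((i : ℝ) • e)]
      congr 1
      ext x; simp
    · intro i _ j _ hij
      exact (hdis hij).mono inter_subset_left inter_subset_left
    · exact fun i _ => (hT i).inter hs
  refine ⟨B, W, (w : ℝ≥0∞)⁻¹ • ∑ i ∈ Finset.range w, Measure.dirac ((i : ℝ) • e), hB, hWm, hBv,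
    ?_, ⟨?_⟩, ?_⟩
  · have := hWs univ MeasurableSet.univ
    simpa [hBv] using this
  · simp [ENNReal.inv_mul_cancel hw0 hwt]
  · have hWv : volume W = w * ENNReal.ofReal v := by
      have := hWs univ MeasurableSet.univ
      simpa [hBv] using this
    have : IsProbabilityMeasure (ProbabilityTheory.cond volume B) :=
      ProbabilityTheory.cond_isProbabilityMeasure_of_finite (by rwa [hBv]) (by simp [hBv])
    ext s hs
    have hms : Measurable fun x : (Fin d → ℝ) × (Fin d → ℝ) => x.1 + x.2 := measurable_add
    have hmq : Measurable fun x =>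
        ProbabilityTheory.cond volume B (Prod.mk x ⁻¹' ((fun x => x.1 + x.2) ⁻¹' s)) :=
      measurable_measure_prodMk_left (hms hs)
    rw [Measure.conv, Measure.map_apply hms hs, Measure.prod_apply (hms hs),
      lintegral_smul_measure, lintegral_finsetSum_measure,
      ProbabilityTheory.cond_apply hWm, hWs s hs, hWv]
    rw [Finset.sum_congr rfl fun (i : ℕ) _ => lintegral_dirac' ((i : ℝ) • e) hmq]
    simp only [ProbabilityTheory.cond_apply hB, hBv, smul_eq_mul]
    rw [← Finset.mul_sum, ENNReal.mul_inv (Or.inl hw0) (Or.inl hwt), mul_assoc]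
    rfl

/-! ### Sequences with independent blocks -/

theorem block_add (α : ℕ → ℕ+) (k : ℕ) (x y : ℕ → ℝ) :
    block α k (x + y) = block α k x + block α k y := rfl

theorem ext_block {α : ℕ → ℕ+} {x y : ℕ → ℝ} (h : ∀ k, block α k x = block α k y) : x = y := by
  ext i
  obtain ⟨k, j, rfl⟩ := exists_block_index α i
  exact congrFun (h k) j

/-- The sequence with prescribed blocks. -/
noncomputable def unblock (α : ℕ → ℕ+) (y : (k : ℕ) → Fin (α k) → ℝ) : ℕ → ℝ :=
  (exists_blocks α y).choose

@[simp]
theorem block_unblock (α : ℕ → ℕ+) (y : (k : ℕ) → Fin (α k) → ℝ) (k : ℕ) :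
    block α k (unblock α y) = y k :=
  (exists_blocks α y).choose_spec k

theorem unblock_add (α : ℕ → ℕ+) (x y : (k : ℕ) → Fin (α k) → ℝ) :
    unblock α (x + y) = unblock α x + unblock α y :=
  ext_block (α := α) fun k => by simp [block_add]

theorem measurable_unblock (α : ℕ → ℕ+) : Measurable (unblock α) := by
  refine measurable_pi_lambda _ fun i => ?_
  obtain ⟨k, j, rfl⟩ := exists_block_index α i
  have : (fun y => unblock α y (blockStart α k + j)) = fun y => y k j := by
    ext y
    exact congrFun (block_unblock α y k) j
  rw [this]
  exact (measurable_pi_apply j).comp (measurable_pi_apply k)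

theorem unblock_preimage_rectangle (α : ℕ → ℕ+) (R : (k : ℕ) → Set (Fin (α k) → ℝ)) :
    unblock α ⁻¹' rectangle α R = Set.pi univ R := by
  ext y
  simp [rectangle]

/-- The measure on sequences with independent blocks of the given laws. -/
noncomputable def blockProd (α : ℕ → ℕ+) (p : (k : ℕ) → Measure (Fin (α k) → ℝ)) :
    Measure (ℕ → ℝ) :=
  (Measure.infinitePi p).map (unblock α)

section BlockProd

variable {α : ℕ → ℕ+} (p q : (k : ℕ) → Measure (Fin (α k) → ℝ))
  [∀ k, IsProbabilityMeasure (p k)] [∀ k, IsProbabilityMeasure (q k)]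

instance : IsProbabilityMeasure (blockProd α p) :=
  Measure.isProbabilityMeasure_map (measurable_unblock α).aemeasurable

theorem blockProd_rectangle_le {R : (k : ℕ) → Set (Fin (α k) → ℝ)}
    (hR : ∀ k, MeasurableSet (R k)) (n : ℕ) :
    blockProd α p (rectangle α R) ≤ ∏ k ∈ Finset.range n, p k (R k) := by
  rw [blockProd, Measure.map_apply (measurable_unblock α) (measurableSet_rectangle hR),
    unblock_preimage_rectangle, ← Measure.infinitePi_pi p fun k _ => hR k]
  exact measure_mono (Set.pi_mono' (fun _ _ => le_rfl) (subset_univ _))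

theorem blockProd_rectangle_eq_one {R : (k : ℕ) → Set (Fin (α k) → ℝ)}
    (hR : ∀ k, MeasurableSet (R k)) (h1 : ∀ k, p k (R k) = 1) :
    blockProd α p (rectangle α R) = 1 := by
  rw [blockProd, Measure.map_apply (measurable_unblock α) (measurableSet_rectangle hR),
    unblock_preimage_rectangle, Measure.infinitePi_pi_univ p hR]
  simp [h1]

theorem blockProd_conv_blockProd :
    (blockProd α p).conv (blockProd α q) = blockProd α fun k => (p k).conv (q k) := by
  have hadd : Measurable fun x : (∀ k, Fin (α k) → ℝ) × (∀ k, Fin (α k) → ℝ) => x.1 + x.2 :=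
    measurable_add
  simp only [blockProd, ← infinitePi_conv_infinitePi]
  rw [Measure.conv, Measure.conv, Measure.map_prod_map _ _ (measurable_unblock α)
    (measurable_unblock α), Measure.map_map measurable_add
      ((measurable_unblock α).prodMap (measurable_unblock α)),
    Measure.map_map (measurable_unblock α) hadd]
  congr 1
  ext x : 1
  exact (unblock_add α x.1 x.2).symm

end BlockProd

/-! ### Ordinary Lebesgue measure compared with product probabilities -/

theorem blockProd_cond_rectangle_le {α : ℕ → ℕ+} {Q R : (k : ℕ) → Set (Fin (α k) → ℝ)}
    (hQ : ∀ k, MeasurableSet (Q k)) (h0 : ∀ k, volume (Q k) ≠ 0) (ht : ∀ k, volume (Q k) ≠ ∞)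
    (hR : ∀ k, MeasurableSet (R k)) (n : ℕ) :
    blockProd α (fun k => ProbabilityTheory.cond volume (Q k)) (rectangle α R) ≤
      (∏ k ∈ Finset.range n, volume (Q k))⁻¹ * ∏ k ∈ Finset.range n, volume (Q k ∩ R k) := by
  have : ∀ k, IsProbabilityMeasure (ProbabilityTheory.cond volume (Q k)) := fun k =>
    ProbabilityTheory.cond_isProbabilityMeasure_of_finite (h0 k) (ht k)
  refine (blockProd_rectangle_le _ hR n).trans_eq ?_
  simp only [ProbabilityTheory.cond_apply (hQ _)]
  rw [Finset.prod_mul_distrib, ENNReal.prod_inv_distrib fun i _ j _ _ => Or.inl (h0 i)]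

theorem isOrdinaryRectangle_zero {α : ℕ → ℕ+} {R : (k : ℕ) → Set (Fin (α k) → ℝ)}
    (hR : ∀ k, MeasurableSet (R k)) {k : ℕ} (hk : volume (R k) = 0) :
    IsOrdinaryRectangle α R 0 := by
  refine ⟨hR, by simp, tendsto_const_nhds.congr' ?_⟩
  filter_upwards [eventually_gt_atTop k] with n hn
  exact (Finset.prod_eq_zero (Finset.mem_range.2 hn) hk).symm

theorem IsOrdinaryRectangle.volume_ne_zero {α : ℕ → ℕ+} {R : (k : ℕ) → Set (Fin (α k) → ℝ)}
    {β : ℝ≥0∞} (h : IsOrdinaryRectangle α R β) (hβ : β ≠ 0) (k : ℕ) : volume (R k) ≠ 0 := by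
  intro hk
  exact hβ (tendsto_nhds_unique h.2.2 (isOrdinaryRectangle_zero h.1 hk).2.2)

theorem IsOrdinaryRectangle.volume_ne_top {α : ℕ → ℕ+} {R : (k : ℕ) → Set (Fin (α k) → ℝ)}
    {β : ℝ≥0∞} (h : IsOrdinaryRectangle α R β) (h0 : ∀ k, volume (R k) ≠ 0) (k : ℕ) :
    volume (R k) ≠ ∞ := by
  intro hk
  obtain ⟨n, hn, hn'⟩ := ((h.2.2.eventually (gt_mem_nhds (lt_top_iff_ne_top.2 h.2.1))).and
    (eventually_gt_atTop k)).exists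
  rw [← Finset.mul_prod_erase _ _ (Finset.mem_range.2 hn'), hk,
    ENNReal.top_mul (Finset.prod_ne_zero_iff.2 fun i _ => h0 i)] at hn
  exact lt_irrefl _ hn

theorem ordinaryLebesgue_rectangle {α : ℕ → ℕ+} {R : (k : ℕ) → Set (Fin (α k) → ℝ)}
    {β : ℝ≥0∞} (h : IsOrdinaryRectangle α R β) : ordinaryLebesgue α (rectangle α R) = β :=
  (ordinaryLebesgue_isOrdinaryLebesgueMeasure α).2 R β h

theorem ordinaryLebesgue_apply (α : ℕ → ℕ+) {X : Set (ℕ → ℝ)} (hX : MeasurableSet X) :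
    ordinaryLebesgue α X = ordinaryLebesgueOuter α X :=
  toMeasure_apply _ _ hX

/-- It suffices to compare on ordinary rectangles, since the outer measure is the largest one
bounded by their volumes. There the probability is at most the ratio of partial volumes, which tends
to `γ / β`. -/
theorem mul_blockProd_cond_le {α : ℕ → ℕ+} {R : (k : ℕ) → Set (Fin (α k) → ℝ)} {β : ℝ≥0∞}
    (h : IsOrdinaryRectangle α R β) (hβ0 : β ≠ 0) {X : Set (ℕ → ℝ)} (hX : MeasurableSet X) :
    β * blockProd α (fun k => ProbabilityTheory.cond volume (R k)) X ≤ ordinaryLebesgue α X := by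
  have h0 := h.volume_ne_zero hβ0
  have ht := h.volume_ne_top h0
  obtain ⟨hm, hβ, hp⟩ := h
  set P := blockProd α fun k => ProbabilityTheory.cond volume (R k)
  have key : β • P.toOuterMeasure ≤ ordinaryLebesgueOuter α := by
    refine OuterMeasure.le_ofFunction.2 fun s => ?_
    refine le_iInf fun Q => le_iInf fun γ => le_iInf fun h => ?_
    obtain ⟨h, rfl⟩ := h
    simp only [_root_.smul_apply, smul_eq_mul, Measure.coe_toOuterMeasure]
    have hle : P (rectangle α Q) ≤ β⁻¹ * γ := by
      refine ge_of_tendsto (ENNReal.Tendsto.mul (tendsto_inv_iff.2 hp) (Or.inr h.2.1) h.2.2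
        (Or.inr (ENNReal.inv_ne_top.2 hβ0))) (Eventually.of_forall fun n => ?_)
      refine (blockProd_cond_rectangle_le hm h0 ht h.1 n).trans ?_
      gcongr
      exact measure_mono inter_subset_right
    calc β * P (rectangle α Q) ≤ β * (β⁻¹ * γ) := by gcongr
      _ = γ := by rw [← mul_assoc, ENNReal.mul_inv_cancel hβ0 hβ, one_mul]
  rw [ordinaryLebesgue_apply α hX]
  exact key X

theorem exists_isOrdinaryRectangle_cover {α : ℕ → ℕ+} {X : Set (ℕ → ℝ)} (hX : MeasurableSet X)
    (hfin : ordinaryLebesgue α X ≠ ∞) :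
    ∃ (R : ℕ → (k : ℕ) → Set (Fin (α k) → ℝ)) (β : ℕ → ℝ≥0∞),
      (∀ j, IsOrdinaryRectangle α (R j) (β j)) ∧ X ⊆ ⋃ j, rectangle α (R j) := by
  rw [ordinaryLebesgue_apply α hX, ordinaryLebesgueOuter, OuterMeasure.ofFunction_apply] at hfin
  obtain ⟨f, hf⟩ := iInf_lt_iff.1 hfin.lt_top
  obtain ⟨hcov, hf⟩ := iInf_lt_iff.1 hf
  have h1 : ∀ j, ∃ R β, IsOrdinaryRectangle α R β ∧ f j = rectangle α R := by
    intro j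
    have : rectangleVolume α (f j) < ∞ := (ENNReal.le_tsum j).trans_lt hf
    obtain ⟨R, hR⟩ := iInf_lt_iff.1 this
    obtain ⟨β, hβ⟩ := iInf_lt_iff.1 hR
    obtain ⟨h, -⟩ := iInf_lt_iff.1 hβ
    exact ⟨R, β, h⟩
  choose R β h hfR using h1
  exact ⟨R, β, h, hcov.trans (iUnion_mono fun j => (hfR j).le)⟩

theorem exists_isOrdinaryRectangle_measure_inter_ne_zero {α : ℕ → ℕ+} {ν : Measure (ℕ → ℝ)}
    {X Y : Set (ℕ → ℝ)} (hY : MeasurableSet Y) (hXY : X ⊆ Y)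
    (hfin : ordinaryLebesgue α Y ≠ ∞) (hX : ν X ≠ 0) :
    ∃ R β, IsOrdinaryRectangle α R β ∧ ν (X ∩ rectangle α R) ≠ 0 := by
  obtain ⟨R, β, h, hcov⟩ := exists_isOrdinaryRectangle_cover hY hfin
  by_contra! hcon
  refine hX (measure_mono_null (t := ⋃ j, X ∩ rectangle α (R j)) ?_
    (measure_iUnion_null fun j => hcon _ _ (h j)))
  rw [← inter_iUnion]
  exact subset_inter Subset.rfl (hXY.trans hcov)

/-- A rectangle of finite measure whose blocks have positive finite volumes is ordinary. -/
theorem isOrdinaryRectangle_of_measure_ne_top {α : ℕ → ℕ+}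
    {Q : (k : ℕ) → Set (Fin (α k) → ℝ)} (hQ : ∀ k, MeasurableSet (Q k))
    (h0 : ∀ k, volume (Q k) ≠ 0) (ht : ∀ k, volume (Q k) ≠ ∞)
    (hfin : ordinaryLebesgue α (rectangle α Q) ≠ ∞) :
    IsOrdinaryRectangle α Q (ordinaryLebesgue α (rectangle α Q)) := by
  suffices H : ∃ β, IsOrdinaryRectangle α Q β by
    obtain ⟨β, hβ⟩ := H
    rwa [ordinaryLebesgue_rectangle hβ]
  have hprob : ∀ k, IsProbabilityMeasure (ProbabilityTheory.cond volume (Q k)) := fun k =>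
    ProbabilityTheory.cond_isProbabilityMeasure_of_finite (h0 k) (ht k)
  set P := blockProd α fun k => ProbabilityTheory.cond volume (Q k) with hP
  have hPQ : P (rectangle α Q) ≠ 0 := by
    rw [hP, blockProd_rectangle_eq_one _ hQ]
    · simp
    · intro k
      rw [ProbabilityTheory.cond_apply (hQ k), inter_self, ENNReal.inv_mul_cancel (h0 k) (ht k)]
  -- Some ordinary rectangle of a cover of `Q` is charged by the uniform probability on `Q`. The
  -- volumes of `Q` are compared with those of this `R` through the intersections `Q k ∩ R k`.
  obtain ⟨R, β, hR, hPR⟩ := exists_isOrdinaryRectangle_measure_inter_ne_zero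
    (measurableSet_rectangle hQ) Subset.rfl hfin hPQ
  replace hPR : P (rectangle α R) ≠ 0 := fun h => hPR (measure_mono_null inter_subset_right h)
  -- the relative volumes of `R` in `Q`
  set c : ℕ → ℝ≥0∞ := fun k => (volume (Q k))⁻¹ * volume (Q k ∩ R k) with hc
  have hPc : ∀ n, P (rectangle α R) ≤ ∏ k ∈ Finset.range n, c k := by
    intro n
    refine (blockProd_cond_rectangle_le hQ h0 ht hR.1 n).trans_eq ?_
    rw [Finset.prod_mul_distrib, ENNReal.prod_inv_distrib fun i _ j _ _ => Or.inl (h0 i)]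
  have hi0 : ∀ k, volume (Q k ∩ R k) ≠ 0 := by
    intro k hk
    refine hPR (le_antisymm ((hPc (k + 1)).trans_eq ?_) bot_le)
    exact Finset.prod_eq_zero (Finset.mem_range.2 k.lt_succ_self) (by simp [hc, hk])
  have hit : ∀ k, volume (Q k ∩ R k) ≠ ∞ := fun k =>
    measure_ne_top_of_subset inter_subset_left (ht k)
  have hR0 : ∀ k, volume (R k) ≠ 0 := fun k h =>
    hi0 k (measure_mono_null inter_subset_right h)
  have hRt := hR.volume_ne_top hR0
  have hc1 : ∀ k, c k ≤ 1 := fun k => by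
    rw [hc, ← ENNReal.inv_mul_cancel (h0 k) (ht k)]
    dsimp only
    gcongr
    exact inter_subset_left
  have hcanti : Antitone fun n => ∏ k ∈ Finset.range n, c k :=
    antitone_nat_of_succ_le fun n => by
      rw [Finset.prod_range_succ]
      exact mul_le_of_le_one_right' (hc1 n)
  have hclim := tendsto_atTop_iInf hcanti
  set C := ⨅ n, ∏ k ∈ Finset.range n, c k
  have hC0 : C ≠ 0 := fun h => hPR (le_antisymm ((le_iInf hPc).trans h.le) bot_le)
  -- The relative volumes of `Q` in `R`. Both `c` and `g` are at most `1`, so their partial products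
  -- decrease to limits; only the limit of `c` must be nonzero, since only `c` is inverted in `|Q k|
  -- = (c k)⁻¹ * g k * |R k|`.
  set g : ℕ → ℝ≥0∞ := fun k => volume (Q k ∩ R k) * (volume (R k))⁻¹ with hg
  have hg1 : ∀ k, g k ≤ 1 := fun k => by
    rw [hg, ← ENNReal.mul_inv_cancel (hR0 k) (hRt k)]
    dsimp only
    gcongr
    exact inter_subset_right
  have hganti : Antitone fun n => ∏ k ∈ Finset.range n, g k :=
    antitone_nat_of_succ_le fun n => by
      rw [Finset.prod_range_succ]
      exact mul_le_of_le_one_right' (hg1 n)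
  have hglim := tendsto_atTop_iInf hganti
  set G := ⨅ n, ∏ k ∈ Finset.range n, g k
  have hG1 : G ≤ 1 := (iInf_le _ 0).trans (by simp)
  have hGt : G ≠ ∞ := ne_top_of_le_ne_top ENNReal.one_ne_top hG1
  have hk : ∀ k, (c k)⁻¹ * g k * volume (R k) = volume (Q k) := by
    intro k
    have h1 : c k ≠ 0 := mul_ne_zero (ENNReal.inv_ne_zero.2 (ht k)) (hi0 k)
    have h2 : c k ≠ ∞ := ne_top_of_le_ne_top ENNReal.one_ne_top (hc1 k)
    have h3 : g k * volume (R k) = c k * volume (Q k) := by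
      rw [hg, hc]
      dsimp only
      rw [mul_assoc, ENNReal.inv_mul_cancel (hR0 k) (hRt k), mul_one,
        mul_comm (volume (Q k))⁻¹, mul_assoc, ENNReal.inv_mul_cancel (h0 k) (ht k), mul_one]
    rw [mul_assoc, h3, ← mul_assoc, ENNReal.inv_mul_cancel h1 h2, one_mul]
  refine ⟨C⁻¹ * G * β, hQ, ?_, ?_⟩
  · exact ENNReal.mul_ne_top (ENNReal.mul_ne_top (ENNReal.inv_ne_top.2 hC0) hGt) hR.2.1
  · have hCi : Tendsto (fun n => ∏ k ∈ Finset.range n, (c k)⁻¹) atTop (𝓝 C⁻¹) := by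
      refine (tendsto_inv_iff.2 hclim).congr fun n => ?_
      rw [ENNReal.prod_inv_distrib]
      exact fun i _ j _ _ => Or.inl (mul_ne_zero (ENNReal.inv_ne_zero.2 (ht i)) (hi0 i))
    have h1 := ENNReal.Tendsto.mul hCi (Or.inr hGt) hglim (Or.inr (ENNReal.inv_ne_top.2 hC0))
    have h2 := ENNReal.Tendsto.mul h1 (Or.inr hR.2.1) hR.2.2
      (Or.inr (ENNReal.mul_ne_top (ENNReal.inv_ne_top.2 hC0) hGt))
    refine h2.congr fun n => ?_
    rw [← Finset.prod_mul_distrib, ← Finset.prod_mul_distrib]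
    exact Finset.prod_congr rfl fun k _ => hk k

/-- Every real number in `(0, ∞)` is the volume of an ordinary rectangle. -/
theorem exists_isOrdinaryRectangle (α : ℕ → ℕ+) {c : ℝ} (hc : 0 < c) :
    ∃ R, IsOrdinaryRectangle α R (ENNReal.ofReal c) := by
  have h : ∀ k, ∃ B : Set (Fin (α k) → ℝ), MeasurableSet B ∧
      volume B = ENNReal.ofReal (if k = 0 then c else 1) := by
    intro k
    obtain ⟨B, -, hB, hv, -⟩ := exists_box_volume (α k).pos
      (v := if k = 0 then c else 1) (by split_ifs <;> positivity)
    exact ⟨B, hB, hv⟩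
  choose R hR hv using h
  refine ⟨R, hR, ENNReal.ofReal_ne_top, tendsto_const_nhds.congr' ?_⟩
  filter_upwards [eventually_gt_atTop 0] with n hn
  simp only [hv]
  rw [Finset.prod_eq_single 0]
  · simp
  · intro k _ hk; simp [hk]
  · simp; omega

/-- Inside an ordinary rectangle the hyperplane is covered by a rectangle whose block `0` is null,
hence of volume `0`; finiteness of `Z` provides a countable cover by ordinary rectangles. -/
theorem ordinaryLebesgue_inter_hyperplane {α : ℕ → ℕ+} {Z : Set (ℕ → ℝ)} (hZ : MeasurableSet Z)
    (hfin : ordinaryLebesgue α Z ≠ ∞) (c : ℝ) :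
    ordinaryLebesgue α (Z ∩ (fun x => x 0) ⁻¹' {c}) = 0 := by
  by_contra hne
  obtain ⟨R, β, hR, hne⟩ :=
    exists_isOrdinaryRectangle_measure_inter_ne_zero hZ inter_subset_left hfin hne
  set s : Set (Fin (α 0) → ℝ) := {y | y ⟨0, (α 0).pos⟩ = c} with hs
  have hsm : MeasurableSet s := measurableSet_eq_fun (measurable_pi_apply _) measurable_const
  have hsv : volume s = 0 := by
    have : s = Set.pi univ fun j => if j = ⟨0, (α 0).pos⟩ then {c} else univ := by
      ext y
      simp only [hs, mem_ofPred_eq, Set.mem_pi, mem_univ, true_imp_iff]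
      constructor
      · intro h j
        split_ifs with hj
        · rw [hj]; exact h
        · trivial
      · intro h; simpa using h ⟨0, (α 0).pos⟩
    rw [this, volume_pi_pi]
    exact Finset.prod_eq_zero (Finset.mem_univ ⟨0, (α 0).pos⟩) (by simp)
  have h0 : IsOrdinaryRectangle α (Function.update R 0 (R 0 ∩ s)) 0 := by
    refine isOrdinaryRectangle_zero (k := 0) (fun k => ?_) ?_
    · rcases eq_or_ne k 0 with rfl | hk
      · simpa using (hR.1 0).inter hsm
      · simpa [Function.update_of_ne hk] using hR.1 k
    · simpa using measure_mono_null inter_subset_right hsv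
  refine hne (measure_mono_null ?_ (ordinaryLebesgue_rectangle h0))
  rintro x ⟨⟨-, hx⟩, hxR⟩ k
  rcases eq_or_ne k 0 with rfl | hk
  · rw [Function.update_self]
    exact ⟨hxR 0, by simpa [hs, block, blockStart] using hx⟩
  · rw [Function.update_of_ne hk]
    exact hxR k

theorem exists_subset_ordinaryLebesgue_eq {α : ℕ → ℕ+} {Z : Set (ℕ → ℝ)} (hZ : MeasurableSet Z)
    (hfin : ordinaryLebesgue α Z ≠ ∞) {c : ℝ≥0∞} (hc0 : c ≠ 0)
    (hc : c ≤ ordinaryLebesgue α Z) :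
    ∃ X, MeasurableSet X ∧ X ⊆ Z ∧ ordinaryLebesgue α X = c :=
  exists_measurableSet_subset_measure_eq hZ hfin (measurable_pi_apply 0)
    (ordinaryLebesgue_inter_hyperplane hZ hfin) hc0 hc

/-! ### Block-scaling flows with convergent exponents -/

/-- A one-parameter group of Borel automorphisms that maps rectangles to rectangles and multiplies
the volume of the `k`-th block by `exp (t * ρ k)`. -/
structure IsBlockScaling (α : ℕ → ℕ+) (ρ : ℕ → ℝ) (Φ : ℝ → (ℕ → ℝ) → ℕ → ℝ) : Prop where
  zero : ∀ x, Φ 0 x = x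
  add : ∀ s t x, Φ (s + t) x = Φ s (Φ t x)
  measurable : ∀ t, Measurable (Φ t)
  image_rectangle : ∀ (t : ℝ) (R : (k : ℕ) → Set (Fin (α k) → ℝ)), (∀ k, MeasurableSet (R k)) →
    ∃ R' : (k : ℕ) → Set (Fin (α k) → ℝ), (∀ k, MeasurableSet (R' k)) ∧
      (∀ k, volume (R' k) = ENNReal.ofReal (Real.exp (t * ρ k)) * volume (R k)) ∧
      Φ t '' rectangle α R = rectangle α R'

theorem prod_ofReal_exp_mul (t : ℝ) (ρ : ℕ → ℝ) (v : ℕ → ℝ≥0∞) (n : ℕ) :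
    ∏ k ∈ Finset.range n, ENNReal.ofReal (Real.exp (t * ρ k)) * v k =
      ENNReal.ofReal (Real.exp (t * ∑ k ∈ Finset.range n, ρ k)) *
        ∏ k ∈ Finset.range n, v k := by
  rw [Finset.prod_mul_distrib, ← ENNReal.ofReal_prod_of_nonneg fun _ _ => (Real.exp_pos _).le,
    ← Real.exp_sum, Finset.mul_sum]

theorem ofReal_exp_mul_ofReal_exp (a b : ℝ) :
    ENNReal.ofReal (Real.exp a) * ENNReal.ofReal (Real.exp b) =
      ENNReal.ofReal (Real.exp (a + b)) := by
  rw [← ENNReal.ofReal_mul (Real.exp_pos _).le, Real.exp_add]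

theorem ofReal_exp_ne_zero (a : ℝ) : ENNReal.ofReal (Real.exp a) ≠ 0 := by
  simpa using Real.exp_pos a

namespace IsBlockScaling

variable {α : ℕ → ℕ+} {ρ : ℕ → ℝ} {Φ : ℝ → (ℕ → ℝ) → ℕ → ℝ} (h : IsBlockScaling α ρ Φ)
include h

theorem image_image (s t : ℝ) (X : Set (ℕ → ℝ)) : Φ s '' (Φ t '' X) = Φ (s + t) '' X := by
  rw [Set.image_image]
  simp only [h.add]

theorem image_zero (X : Set (ℕ → ℝ)) : Φ 0 '' X = X := by
  simp [h.zero]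

theorem neg_apply (t : ℝ) (x : ℕ → ℝ) : Φ (-t) (Φ t x) = x := by
  rw [← h.add, neg_add_cancel, h.zero]

theorem injective (t : ℝ) : Function.Injective (Φ t) :=
  Function.LeftInverse.injective (h.neg_apply t)

theorem image_eq_preimage (t : ℝ) (X : Set (ℕ → ℝ)) : Φ t '' X = Φ (-t) ⁻¹' X :=
  congrFun (image_eq_preimage_of_inverse (h.neg_apply t)
    fun x => by simpa using h.neg_apply (-t) x) X

theorem measurableSet_image (t : ℝ) {X : Set (ℕ → ℝ)} (hX : MeasurableSet X) :
    MeasurableSet (Φ t '' X) := by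
  rw [h.image_eq_preimage]
  exact h.measurable _ hX

/-- Covers are carried to covers, and the volume of each ordinary rectangle is multiplied by `exp (t
* S)`. The reverse inequality comes from time `-t`. -/
theorem outer_image_le {S : ℝ} (hS : Tendsto (fun N => ∑ k ∈ Finset.range N, ρ k) atTop (𝓝 S))
    (t : ℝ) (X : Set (ℕ → ℝ)) : ordinaryLebesgueOuter α (Φ t '' X) ≤
      ENNReal.ofReal (Real.exp (t * S)) * ordinaryLebesgueOuter α X := by
  set c := ENNReal.ofReal (Real.exp (t * S)) with hc
  have hc0 : c ≠ 0 := ofReal_exp_ne_zero _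
  have hct : c ≠ ∞ := ENNReal.ofReal_ne_top
  have key : c⁻¹ • OuterMeasure.comap (Φ t) (ordinaryLebesgueOuter α) ≤
      ordinaryLebesgueOuter α := by
    refine OuterMeasure.le_ofFunction.2 fun s => ?_
    refine le_iInf fun R => le_iInf fun β => le_iInf fun hR => ?_
    obtain ⟨hR, rfl⟩ := hR
    obtain ⟨R', hm, hv, e⟩ := h.image_rectangle t R hR.1
    simp only [_root_.smul_apply, smul_eq_mul, OuterMeasure.comap_apply, e]
    have hR' : IsOrdinaryRectangle α R' (c * β) := by
      refine ⟨hm, ENNReal.mul_ne_top hct hR.2.1, ?_⟩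
      simp only [IsOrdinaryProduct, hv, prod_ofReal_exp_mul]
      refine ENNReal.Tendsto.mul ?_ (Or.inr hR.2.1) hR.2.2 (Or.inr hct)
      exact ENNReal.tendsto_ofReal
        ((Real.continuous_exp.tendsto _).comp (hS.const_mul t))
    calc c⁻¹ * ordinaryLebesgueOuter α (rectangle α R') ≤ c⁻¹ * (c * β) := by
          gcongr
          exact (OuterMeasure.ofFunction_le _).trans (rectangleVolume_le hR')
      _ = β := by rw [← mul_assoc, ENNReal.inv_mul_cancel hc0 hct, one_mul]
  have := key X
  simp only [_root_.smul_apply, smul_eq_mul, OuterMeasure.comap_apply] at this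
  calc ordinaryLebesgueOuter α (Φ t '' X)
      = c * (c⁻¹ * ordinaryLebesgueOuter α (Φ t '' X)) := by
        rw [← mul_assoc, ENNReal.mul_inv_cancel hc0 hct, one_mul]
    _ ≤ _ := by gcongr

theorem measure_image {S : ℝ} (hS : Tendsto (fun N => ∑ k ∈ Finset.range N, ρ k) atTop (𝓝 S))
    (t : ℝ) {X : Set (ℕ → ℝ)} (hX : MeasurableSet X) : ordinaryLebesgue α (Φ t '' X) =
      ENNReal.ofReal (Real.exp (t * S)) * ordinaryLebesgue α X := by
  rw [ordinaryLebesgue_apply α hX, ordinaryLebesgue_apply α (h.measurableSet_image t hX)]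
  refine le_antisymm (h.outer_image_le hS t X) ?_
  have := h.outer_image_le hS (-t) (Φ t '' X)
  rw [h.image_image, neg_add_cancel, h.image_zero] at this
  calc _ ≤ ENNReal.ofReal (Real.exp (t * S)) * (ENNReal.ofReal (Real.exp (-t * S)) *
        ordinaryLebesgueOuter α (Φ t '' X)) := by gcongr
    _ = _ := by
      rw [← mul_assoc, ofReal_exp_mul_ofReal_exp]
      simp

theorem measurableSet_offeredSet {τ : Set (Set (ℕ → ℝ)) → Set (ℕ → ℝ)} (hτ : IsChoiceOperator τ)
    {t m : ℕ → ℝ} {Y : Set (ℕ → ℝ)} (hY : MeasurableSet Y) (k : ℕ)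
    (hd : ∀ j < k, (demandFamily (ordinaryLebesgue α)
      (offeredSet τ (ordinaryLebesgue α) Φ t m Y j) (m j)).Nonempty) :
    MeasurableSet (offeredSet τ (ordinaryLebesgue α) Φ t m Y k) := by
  induction k with
  | zero => exact h.measurableSet_image _ hY
  | succ k ih =>
    refine h.measurableSet_image _ ((ih fun j hj => hd j (by omega)).diff ?_)
    exact (hτ _ (hd k k.lt_succ_self)).1

/-- What is left at step `k` and what has been consumed before, both carried back to time `0`,
add up to the measure of the initial system. -/
theorem measure_offeredSet {S : ℝ}
    (hS : Tendsto (fun N => ∑ k ∈ Finset.range N, ρ k) atTop (𝓝 S))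
    {τ : Set (Set (ℕ → ℝ)) → Set (ℕ → ℝ)} (hτ : IsChoiceOperator τ)
    {t m : ℕ → ℝ} {Y : Set (ℕ → ℝ)} (hY : MeasurableSet Y) (k : ℕ)
    (hd : ∀ j < k, (demandFamily (ordinaryLebesgue α)
      (offeredSet τ (ordinaryLebesgue α) Φ t m Y j) (m j)).Nonempty) :
    ENNReal.ofReal (Real.exp (-t k * S)) *
        ordinaryLebesgue α (offeredSet τ (ordinaryLebesgue α) Φ t m Y k) +
      ∑ j ∈ Finset.range k, ENNReal.ofReal (Real.exp (-t j * S)) * ENNReal.ofReal (m j) =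
      ordinaryLebesgue α Y := by
  induction k with
  | zero =>
    rw [offeredSet, h.measure_image hS _ hY, ← mul_assoc, ofReal_exp_mul_ofReal_exp]
    simp
  | succ k ih =>
    have hd' := fun j (hj : j < k) => hd j (hj.trans k.lt_succ_self)
    rw [← ih hd', Finset.sum_range_succ, add_comm (Finset.sum _ _), ← add_assoc]
    congr 1
    obtain ⟨hCm, hCs, hCv⟩ := hτ _ (hd k k.lt_succ_self)
    have hZm := h.measurableSet_offeredSet hτ hY k hd'
    rw [offeredSet, h.measure_image hS _ (hZm.diff hCm), ← mul_assoc, ofReal_exp_mul_ofReal_exp,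
      ← hCv, show -t (k + 1) * S + (t (k + 1) - t k) * S = -t k * S by ring, ← mul_add]
    congr 1
    rw [← measure_union disjoint_sdiff_left hCm, sdiff_union_of_subset hCs]

theorem isSPCDSolution {S : ℝ} (hS : Tendsto (fun N => ∑ k ∈ Finset.range N, ρ k) atTop (𝓝 S))
    {τ : Set (Set (ℕ → ℝ)) → Set (ℕ → ℝ)} (hτ : IsChoiceOperator τ) {n : ℕ} (hn : 1 ≤ n)
    {t m : ℕ → ℝ} (hm : ∀ k < n, 0 < m k) :
    IsSPCDSolution τ (ordinaryLebesgue α) Φ n t m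
        (∑ k ∈ Finset.range n, m k * Real.exp (-t k * S)) ∧
      ∀ Y : Set (ℕ → ℝ), MeasurableSet Y →
        ordinaryLebesgue α Y =
          ENNReal.ofReal (∑ k ∈ Finset.range n, m k * Real.exp (-t k * S)) →
        DemandsSatisfied τ (ordinaryLebesgue α) Φ n t m Y := by
  have hpos : ∀ k < n, 0 < m k * Real.exp (-t k * S) := fun k hk =>
    mul_pos (hm k hk) (Real.exp_pos _)
  have hM : ENNReal.ofReal (∑ k ∈ Finset.range n, m k * Real.exp (-t k * S)) =
      ∑ k ∈ Finset.range n, ENNReal.ofReal (Real.exp (-t k * S)) * ENNReal.ofReal (m k) := by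
    rw [ENNReal.ofReal_sum_of_nonneg fun k hk => (hpos k (Finset.mem_range.1 hk)).le]
    refine Finset.sum_congr rfl fun k hk => ?_
    rw [mul_comm, ENNReal.ofReal_mul (Real.exp_pos _).le]
  have hM0 : 0 < ∑ k ∈ Finset.range n, m k * Real.exp (-t k * S) :=
    Finset.sum_pos (fun k hk => hpos k (Finset.mem_range.1 hk)) ⟨0, Finset.mem_range.2 hn⟩
  have hsat : ∀ Y : Set (ℕ → ℝ), MeasurableSet Y →
      ordinaryLebesgue α Y =
        ENNReal.ofReal (∑ k ∈ Finset.range n, m k * Real.exp (-t k * S)) →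
      DemandsSatisfied τ (ordinaryLebesgue α) Φ n t m Y := by
    intro Y hY hYM k
    induction k using Nat.strong_induction_on with
    | _ k ih =>
    intro hk
    have hd := fun j (hj : j < k) => ih j hj (hj.trans hk)
    have hacc := h.measure_offeredSet hS hτ hY k hd
    rw [hYM] at hacc
    set Z := offeredSet τ (ordinaryLebesgue α) Φ t m Y k
    have hfin : ordinaryLebesgue α Z ≠ ∞ := by
      intro htop
      rw [htop, ENNReal.mul_top (ofReal_exp_ne_zero _), top_add] at hacc
      exact ENNReal.ofReal_ne_top hacc.symm
    -- Cancelling the finite consumed part leaves the discounted demands of consumers `k, …, n - 1`,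
    -- which include that of `k`.
    have hle : ENNReal.ofReal (m k) ≤ ordinaryLebesgue α Z := by
      rw [hM, ← Finset.sum_range_add_sum_Ico _ hk.le, add_comm] at hacc
      have hst : ∑ j ∈ Finset.range k,
          ENNReal.ofReal (Real.exp (-t j * S)) * ENNReal.ofReal (m j) ≠ ∞ :=
        ENNReal.sum_ne_top.2 fun j _ =>
          ENNReal.mul_ne_top ENNReal.ofReal_ne_top ENNReal.ofReal_ne_top
      have h1 := (ENNReal.add_right_inj hst).1 hacc
      have h2 : ENNReal.ofReal (Real.exp (-t k * S)) * ENNReal.ofReal (m k) ≤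
          ∑ j ∈ Finset.Ico k n, ENNReal.ofReal (Real.exp (-t j * S)) * ENNReal.ofReal (m j) :=
        Finset.single_le_sum_of_canonicallyOrdered
          (f := fun j => ENNReal.ofReal (Real.exp (-t j * S)) * ENNReal.ofReal (m j))
          (Finset.mem_Ico.2 ⟨le_rfl, hk⟩)
      rw [← h1] at h2
      exact (ENNReal.mul_le_mul_iff_right (ofReal_exp_ne_zero _) ENNReal.ofReal_ne_top).1 h2
    obtain ⟨X, hX, hXZ, hXm⟩ := exists_subset_ordinaryLebesgue_eq
      (h.measurableSet_offeredSet hτ hY k hd) hfin (by simpa using hm k hk) hle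
    exact ⟨X, hX, hXZ, hXm⟩
  refine ⟨⟨?_, ?_⟩, hsat⟩
  · obtain ⟨R, hR⟩ := exists_isOrdinaryRectangle α hM0
    refine ⟨rectangle α R, measurableSet_rectangle hR.1, ?_,
      hsat _ (measurableSet_rectangle hR.1) (ordinaryLebesgue_rectangle hR),
      ordinaryLebesgue_rectangle hR⟩
    rw [ordinaryLebesgue_rectangle hR]
    simpa using hM0
  · rintro _ ⟨Y, hY, -, hd, rfl⟩
    -- The balance is taken just before the last consumer, whose demand is bounded by what is then
    -- offered.
    obtain ⟨n, rfl⟩ : ∃ n', n = n' + 1 := ⟨n - 1, by omega⟩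
    obtain ⟨X, -, hXZ, hXm⟩ := hd n n.lt_succ_self
    rw [hM, ← h.measure_offeredSet hS hτ hY n fun j hj => hd j (hj.trans n.lt_succ_self),
      Finset.sum_range_succ, add_comm, ← hXm]
    gcongr

end IsBlockScaling

/-! ### Meeting one demand forces the scaling factors to have a limit -/

theorem rectangle_inter (α : ℕ → ℕ+) (R Q : (k : ℕ) → Set (Fin (α k) → ℝ)) :
    rectangle α (fun k => R k ∩ Q k) = rectangle α R ∩ rectangle α Q := by
  ext x
  simp [rectangle, forall_and]

namespace IsBlockScaling

variable {α : ℕ → ℕ+} {ρ : ℕ → ℝ} {Φ : ℝ → (ℕ → ℝ) → ℕ → ℝ} (h : IsBlockScaling α ρ Φ)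
include h

/-- If the image of a set of finite measure contains a set of positive finite measure, then the
scaling factors of the finite-dimensional volumes have a nonzero, possibly infinite, limit. -/
theorem exists_tendsto_exp {t : ℝ} {Y C : Set (ℕ → ℝ)} (hY : MeasurableSet Y)
    (hYfin : ordinaryLebesgue α Y ≠ ∞) (hC : MeasurableSet C) (hCY : C ⊆ Φ t '' Y)
    (hC0 : ordinaryLebesgue α C ≠ 0) (hCfin : ordinaryLebesgue α C ≠ ∞) :
    ∃ L : ℝ≥0∞, L ≠ 0 ∧ Tendsto
      (fun N => ENNReal.ofReal (Real.exp (t * ∑ k ∈ Finset.range N, ρ k))) atTop (𝓝 L) := by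
  obtain ⟨R, β, hR, hCR⟩ :=
    exists_isOrdinaryRectangle_measure_inter_ne_zero hC Subset.rfl hCfin hC0
  obtain ⟨D, δ, hD, hCRD⟩ : ∃ D δ, IsOrdinaryRectangle α D δ ∧
      ordinaryLebesgue α (C ∩ rectangle α R ∩ Φ t '' rectangle α D) ≠ 0 := by
    obtain ⟨D, δ, hD, hcov⟩ := exists_isOrdinaryRectangle_cover hY hYfin
    by_contra! hcon
    refine hCR (measure_mono_null (t := ⋃ j, C ∩ rectangle α R ∩ Φ t '' rectangle α (D j)) ?_
      (measure_iUnion_null fun j => hcon _ _ (hD j)))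
    rw [← inter_iUnion, ← image_iUnion]
    exact subset_inter Subset.rfl
      (inter_subset_left.trans (hCY.trans (image_mono hcov)))
  obtain ⟨D', hD'm, hD'v, e⟩ := h.image_rectangle t D hD.1
  have hβ : β ≠ 0 := by
    rintro rfl
    exact hCR (measure_mono_null inter_subset_right (ordinaryLebesgue_rectangle hR))
  have hRt := hR.volume_ne_top (hR.volume_ne_zero hβ)
  set Q : (k : ℕ) → Set (Fin (α k) → ℝ) := fun k => R k ∩ D' k with hQ
  have hQm : ∀ k, MeasurableSet (Q k) := fun k => (hR.1 k).inter (hD'm k)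
  have hQne : ordinaryLebesgue α (rectangle α Q) ≠ 0 := by
    refine fun h0 => hCRD (measure_mono_null ?_ h0)
    rw [hQ, rectangle_inter, ← e]
    exact inter_subset_inter_left _ inter_subset_right
  have hQ0 : ∀ k, volume (Q k) ≠ 0 := fun k hk =>
    hQne (ordinaryLebesgue_rectangle (isOrdinaryRectangle_zero hQm hk))
  have hQt : ∀ k, volume (Q k) ≠ ∞ := fun k =>
    measure_ne_top_of_subset inter_subset_left (hRt k)
  have hQfin : ordinaryLebesgue α (rectangle α Q) ≠ ∞ := by
    refine ne_top_of_le_ne_top hR.2.1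
      ((measure_mono ?_).trans_eq (ordinaryLebesgue_rectangle hR))
    rw [hQ, rectangle_inter]
    exact inter_subset_left
  have hQo := isOrdinaryRectangle_of_measure_ne_top hQm hQ0 hQt hQfin
  have hD0 : ∀ k, volume (D k) ≠ 0 := by
    intro k hk
    have : volume (D' k) = 0 := by rw [hD'v, hk, mul_zero]
    exact hQ0 k (measure_mono_null inter_subset_right this)
  have hDt := hD.volume_ne_top hD0
  -- The ratio of the volumes of `D' k` and `Q k ⊆ D' k`. It is at least `1`, so its partial
  -- products increase, and `exp (t S_N)` is the product of the `u k` times the volume of `Q` over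
  -- that of `D`.
  set u : ℕ → ℝ≥0∞ := fun k =>
    ENNReal.ofReal (Real.exp (t * ρ k)) * volume (D k) * (volume (Q k))⁻¹ with hu
  have hu1 : ∀ k, 1 ≤ u k := by
    intro k
    rw [hu, ← ENNReal.mul_inv_cancel (hQ0 k) (hQt k)]
    dsimp only
    rw [← hD'v]
    gcongr
    exact inter_subset_right
  have hmono : Monotone fun n => ∏ k ∈ Finset.range n, u k :=
    monotone_nat_of_le_succ fun n => by
      rw [Finset.prod_range_succ]
      exact le_mul_of_one_le_right' (hu1 n)
  have hlim := tendsto_atTop_iSup hmono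
  set U := ⨆ n, ∏ k ∈ Finset.range n, u k
  have hU0 : U ≠ 0 := by
    have : 1 ≤ U := le_iSup_of_le 0 (by simp)
    exact (one_pos.trans_le this).ne'
  -- Here `δ` may be `0` and `U` may be `∞`; since all three limits are nonzero, no product `0 * ∞`
  -- arises.
  have hδ : δ⁻¹ ≠ 0 := ENNReal.inv_ne_zero.2 hD.2.1
  have h1 := ENNReal.Tendsto.mul hlim (Or.inl hU0) hQo.2.2 (Or.inl hQne)
  have h2 := ENNReal.Tendsto.mul h1 (Or.inl (mul_ne_zero hU0 hQne))
    (tendsto_inv_iff.2 hD.2.2) (Or.inl hδ)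
  refine ⟨_, mul_ne_zero (mul_ne_zero hU0 hQne) hδ, h2.congr fun n => ?_⟩
  have hd0 : ∏ k ∈ Finset.range n, volume (D k) ≠ 0 := Finset.prod_ne_zero_iff.2 fun k _ => hD0 k
  have hdt : ∏ k ∈ Finset.range n, volume (D k) ≠ ∞ := ENNReal.prod_ne_top fun k _ => hDt k
  have huQ : (∏ k ∈ Finset.range n, u k) * ∏ k ∈ Finset.range n, volume (Q k) =
      ENNReal.ofReal (Real.exp (t * ∑ k ∈ Finset.range n, ρ k)) *
        ∏ k ∈ Finset.range n, volume (D k) := by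
    rw [← prod_ofReal_exp_mul, ← Finset.prod_mul_distrib]
    refine Finset.prod_congr rfl fun k _ => ?_
    rw [hu]
    dsimp only
    rw [mul_assoc, ENNReal.inv_mul_cancel (hQ0 k) (hQt k), mul_one]
  rw [huQ, mul_assoc, ENNReal.mul_inv_cancel hd0 hdt, mul_one]

end IsBlockScaling

/-! ### Unbounded expansion: null reservoirs -/

theorem tendsto_of_tendsto_ofReal_exp {s : ℕ → ℝ} {L : ℝ≥0∞} (hL : L ≠ 0) {t : ℝ} (ht : 0 < t)
    (h : Tendsto (fun N => ENNReal.ofReal (Real.exp (t * s N))) atTop (𝓝 L)) :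
    Tendsto s atTop atTop ∨ ∃ S, Tendsto s atTop (𝓝 S) := by
  have hs : ∀ f : ℕ → ℝ, (fun N => t⁻¹ * (t * f N)) = f := fun f => by
    ext N; field_simp
  rcases eq_or_ne L ∞ with rfl | hLt
  · left
    rw [ENNReal.tendsto_ofReal_nhds_top, Real.tendsto_exp_comp_atTop] at h
    rw [← hs s]
    exact h.const_mul_atTop (inv_pos.2 ht)
  · right
    have h1 := (ENNReal.tendsto_toReal hLt).comp h
    have hL0 : L.toReal ≠ 0 := (ENNReal.toReal_pos hL hLt).ne'
    have h2 := ((Real.continuousAt_log hL0).tendsto.comp h1).const_mul t⁻¹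
    refine ⟨_, h2.congr fun N => ?_⟩
    simp only [Function.comp, ENNReal.toReal_ofReal (Real.exp_pos _).le, Real.log_exp]
    field_simp

/-- A monotone minorant of a multiple of a sequence tending to infinity that is frequently
attained up to a constant. -/
theorem exists_monotone_exponents {s : ℕ → ℝ} (hs : Tendsto s atTop atTop) {c T : ℝ}
    (hc : 0 < c) (hcT : c ≤ T) : ∃ a : ℕ → ℕ, Monotone a ∧
      Tendsto (fun N => (a N : ℝ) * Real.log 2 - T * s N) atTop atBot ∧
      ∀ K : ℝ, ∃ᶠ N in atTop, K ≤ (a N : ℝ) * Real.log 2 - (T - c) * s N := by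
  have hl : 0 < Real.log 2 := Real.log_pos one_lt_two
  -- The growth rate is halfway between `T - c` and `T`, measured in powers of `2`.
  set θ := (T - c / 2) / Real.log 2 with hθ
  have hθ0 : 0 < θ := div_pos (by linarith) hl
  have hθl : θ * Real.log 2 = T - c / 2 := div_mul_cancel₀ _ hl.ne'
  set g : ℕ → ℕ := fun N => ⌊θ * s N⌋₊ with hg
  -- The infimum over the tail makes the exponents monotone. It is attained, and equality `a M = g
  -- M` holds at every point `M` where it is.
  set a : ℕ → ℕ := fun N => sInf (g '' Ici N) with ha
  have hne : ∀ N, (g '' Ici N).Nonempty := fun N => ⟨_, N, mem_Ici.2 le_rfl, rfl⟩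
  have hag : ∀ N M, N ≤ M → a N ≤ g M := fun N M h => Nat.sInf_le ⟨M, h, rfl⟩
  refine ⟨a, fun N M h => ?_, ?_, fun K => ?_⟩
  · obtain ⟨P, hP, hPM⟩ := Nat.sInf_mem (hne M)
    have : a M = g P := hPM.symm
    rw [this]
    exact hag N P (h.trans hP)
  · have h1 : Tendsto (fun N => -(c / 2) * s N) atTop atBot :=
      hs.const_mul_atTop_of_neg (by linarith)
    refine tendsto_atBot_mono' _ ?_ h1
    filter_upwards [hs.eventually_ge_atTop 0] with N hN
    have h2 : (a N : ℝ) ≤ θ * s N :=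
      (Nat.cast_le.2 (hag N N le_rfl)).trans (Nat.floor_le (mul_nonneg hθ0.le hN))
    have h3 := mul_le_mul_of_nonneg_right h2 hl.le
    have h4 : θ * s N * Real.log 2 = (T - c / 2) * s N := by rw [← hθl]; ring
    linarith
  · rw [frequently_atTop]
    intro N₀
    obtain ⟨N₁, hN₁⟩ := eventually_atTop.1
      (hs.eventually_ge_atTop ((K + Real.log 2) / (c / 2)))
    obtain ⟨M, hM, hMa⟩ := Nat.sInf_mem (hne (max N₀ N₁))
    have hM' : max N₀ N₁ ≤ M := hM
    refine ⟨M, (le_max_left _ _).trans hM', ?_⟩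
    have haM : a M = g M := by
      refine le_antisymm (hag M M le_rfl) ?_
      obtain ⟨P, hP, hPM⟩ := Nat.sInf_mem (hne M)
      have : a M = g P := hPM.symm
      rw [this, hMa]
      exact hag _ P (hM'.trans hP)
    have h1 := hN₁ M ((le_max_right _ _).trans hM')
    rw [div_le_iff₀ (by linarith)] at h1
    have h2 : θ * s M - 1 ≤ a M := by
      rw [haM]
      exact (Nat.sub_one_lt_floor _).le
    have h3 := mul_le_mul_of_nonneg_right h2 hl.le
    have h4 : θ * s M * Real.log 2 = (T - c / 2) * s M := by rw [← hθl]; ring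
    linarith

namespace IsBlockScaling

variable {α : ℕ → ℕ+} {ρ : ℕ → ℝ} {Φ : ℝ → (ℕ → ℝ) → ℕ → ℝ} (h : IsBlockScaling α ρ Φ)
include h

/-- The images of the ordinary rectangles covering `C` have partial volumes of order at most `exp (r
S_N)`, negligible against those of `W` along `φ`. A subsequence suffices because every cylinder
bounds the probability of the rectangle. -/
theorem blockProd_cond_image_eq_zero {W : (k : ℕ) → Set (Fin (α k) → ℝ)}
    (hW : ∀ k, MeasurableSet (W k)) (h0 : ∀ k, volume (W k) ≠ 0) (ht : ∀ k, volume (W k) ≠ ∞)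
    {r : ℝ} {φ : ℕ → ℕ} (hφ : Tendsto φ atTop atTop)
    (hlim : Tendsto (fun i => (∏ k ∈ Finset.range (φ i), volume (W k))⁻¹ *
      ENNReal.ofReal (Real.exp (r * ∑ k ∈ Finset.range (φ i), ρ k))) atTop (𝓝 0))
    {C : Set (ℕ → ℝ)} (hC : MeasurableSet C) (hfin : ordinaryLebesgue α C ≠ ∞) :
    blockProd α (fun k => ProbabilityTheory.cond volume (W k)) (Φ r '' C) = 0 := by
  obtain ⟨R, β, hR, hcov⟩ := exists_isOrdinaryRectangle_cover hC hfin
  refine measure_mono_null ((image_mono hcov).trans (image_iUnion ..).le)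
    (measure_iUnion_null fun j => ?_)
  obtain ⟨R', hm, hv, e⟩ := h.image_rectangle r (R j) (hR j).1
  rw [e]
  have h1 := ENNReal.Tendsto.mul hlim (Or.inr (hR j).2.1) ((hR j).2.2.comp hφ)
    (Or.inr ENNReal.zero_ne_top)
  rw [zero_mul] at h1
  refine le_antisymm (ge_of_tendsto h1 (Eventually.of_forall fun i => ?_)) bot_le
  refine (blockProd_cond_rectangle_le hW h0 ht hm (φ i)).trans ?_
  simp only [Function.comp]
  rw [mul_assoc, ← prod_ofReal_exp_mul, ← Finset.prod_congr rfl fun k _ => hv k]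
  gcongr
  exact inter_subset_right

/-- A null set `D` whose image at time `T` retains subsets of measure `m` whatever sets of finite
measure are removed at times at least `c`. -/
theorem exists_reservoir (hs : Tendsto (fun N => ∑ k ∈ Finset.range N, ρ k) atTop atTop)
    {c T m : ℝ} (hc : 0 < c) (hcT : c ≤ T) (hm : 0 < m) :
    ∃ D, MeasurableSet D ∧ ordinaryLebesgue α D = 0 ∧
      ∀ (n : ℕ) (u : ℕ → ℝ) (C : ℕ → Set (ℕ → ℝ)),
        (∀ j < n, c ≤ u j ∧ MeasurableSet (C j) ∧ ordinaryLebesgue α (C j) ≠ ∞) →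
        ∃ X, MeasurableSet X ∧ X ⊆ Φ T '' D ∧ (∀ j < n, Disjoint X (Φ (T - u j) '' C j)) ∧
          ordinaryLebesgue α X = ENNReal.ofReal m := by
  obtain ⟨a, ha, ha1, ha2⟩ := exists_monotone_exponents hs hc hcT
  -- `W` consists of `2 ^ (a (k + 1) - a k)` translates of `B`, so its partial volumes telescope to
  -- `2 ^ (a N - a 0) * m`. The count is written as an exponential, with a factor `1`, to fit
  -- `prod_ofReal_exp_mul`.
  have hcell : ∀ k, ∃ (B W : Set (Fin (α k) → ℝ)) (p : Measure (Fin (α k) → ℝ)),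
      MeasurableSet B ∧ MeasurableSet W ∧ volume B = ENNReal.ofReal (if k = 0 then m else 1) ∧
      volume W = ENNReal.ofReal (Real.exp (1 * ((a (k + 1) - a k : ℝ) * Real.log 2))) *
        ENNReal.ofReal (if k = 0 then m else 1) ∧
      IsProbabilityMeasure p ∧
      p.conv (ProbabilityTheory.cond volume B) = ProbabilityTheory.cond volume W := by
    intro k
    obtain ⟨B, W, p, hB, hW, hBv, hWv, hp⟩ := exists_cell_decomposition (α k).pos
      (v := if k = 0 then m else 1) (by split_ifs <;> positivity)
      (w := 2 ^ (a (k + 1) - a k)) (by positivity)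
    refine ⟨B, W, p, hB, hW, hBv, ?_, hp⟩
    rw [hWv]
    congr 1
    rw [one_mul, ← Nat.cast_sub (ha k.le_succ), mul_comm, Real.exp_mul,
      Real.exp_log two_pos, Real.rpow_natCast, ENNReal.ofReal_pow two_pos.le]
    simp
  choose B W p hB hW hBv hWv hp hconv using hcell
  have hv : ∀ N, 1 ≤ N → ∏ k ∈ Finset.range N, ENNReal.ofReal (if k = 0 then m else 1) =
      ENNReal.ofReal m := by
    intro N hN
    rw [Finset.prod_eq_single 0]
    · simp
    · intro k _ hk; simp [hk]
    · simp; omega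
  have hB0 : ∀ k, volume (B k) ≠ 0 := fun k => by
    rw [hBv]
    split_ifs <;> simp [hm]
  have hBt : ∀ k, volume (B k) ≠ ∞ := fun k => by simp [hBv]
  have hW0 : ∀ k, volume (W k) ≠ 0 := fun k => by
    rw [hWv, ← hBv]
    exact mul_ne_zero (ofReal_exp_ne_zero _) (hB0 k)
  have hWt : ∀ k, volume (W k) ≠ ∞ := fun k => by
    rw [hWv]
    exact ENNReal.mul_ne_top ENNReal.ofReal_ne_top ENNReal.ofReal_ne_top
  have hWprod : ∀ N, 1 ≤ N → ∏ k ∈ Finset.range N, volume (W k) =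
      ENNReal.ofReal (Real.exp ((a N - a 0 : ℝ) * Real.log 2)) * ENNReal.ofReal m := by
    intro N hN
    simp only [hWv]
    rw [prod_ofReal_exp_mul, hv N hN, ← Finset.sum_mul,
      Finset.sum_range_sub (fun k => (a k : ℝ)), one_mul]
  have hBord : IsOrdinaryRectangle α B (ENNReal.ofReal m) := by
    refine ⟨hB, ENNReal.ofReal_ne_top, tendsto_const_nhds.congr' ?_⟩
    filter_upwards [eventually_ge_atTop 1] with N hN
    simp only [hBv, hv N hN]
  have hmpos : ENNReal.ofReal m ≠ 0 := by simpa using hm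
  have hBprob : ∀ k, IsProbabilityMeasure (ProbabilityTheory.cond volume (B k)) := fun k =>
    ProbabilityTheory.cond_isProbabilityMeasure_of_finite (hB0 k) (hBt k)
  have hWprob : ∀ k, IsProbabilityMeasure (ProbabilityTheory.cond volume (W k)) := fun k =>
    ProbabilityTheory.cond_isProbabilityMeasure_of_finite (hW0 k) (hWt k)
  have hcond : ∀ k (Q : Set (Fin (α k) → ℝ)), MeasurableSet Q → volume Q ≠ 0 → volume Q ≠ ∞ →
      ProbabilityTheory.cond volume Q Q = 1 := fun k Q hQ h0 ht => by
    rw [ProbabilityTheory.cond_apply hQ, inter_self, ENNReal.inv_mul_cancel h0 ht]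
  set PB := blockProd α fun k => ProbabilityTheory.cond volume (B k) with hPB
  set PW := blockProd α fun k => ProbabilityTheory.cond volume (W k) with hPW
  have hPWc : (blockProd α p).conv PB = PW := by
    rw [hPB, blockProd_conv_blockProd]
    simp only [hconv, hPW]
  have hWm := measurableSet_rectangle hW
  refine ⟨Φ (-T) '' rectangle α W, h.measurableSet_image _ hWm, ?_, ?_⟩
  · obtain ⟨W', hW'm, hW'v, e⟩ := h.image_rectangle (-T) W hW
    rw [e]
    refine ordinaryLebesgue_rectangle ⟨hW'm, ENNReal.zero_ne_top, ?_⟩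
    simp only [IsOrdinaryProduct, hW'v, prod_ofReal_exp_mul]
    have h1 : Tendsto (fun N => ENNReal.ofReal (Real.exp (((a N : ℝ) * Real.log 2 -
        T * ∑ k ∈ Finset.range N, ρ k) + -(a 0 * Real.log 2))) * ENNReal.ofReal m)
        atTop (𝓝 0) := by
      have h2 := ENNReal.tendsto_ofReal
        (Real.tendsto_exp_atBot.comp (tendsto_atBot_add_const_right _ (-(a 0 * Real.log 2)) ha1))
      have h3 := ENNReal.Tendsto.mul_const h2 (Or.inr (ENNReal.ofReal_ne_top (r := m)))
      simpa using h3
    refine h1.congr' ?_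
    filter_upwards [eventually_ge_atTop 1] with N hN
    rw [hWprod N hN, ← mul_assoc, ofReal_exp_mul_ofReal_exp]
    congr 3
    ring
  · intro n u C hC
    have hnull : ∀ j < n, PW (Φ (T - u j) '' C j) = 0 := by
      intro j hj
      obtain ⟨hu, hCm, hCf⟩ := hC j hj
      -- Along `φ` the volumes of `W` exceed `exp ((T - c) S_N)` by a factor of order `exp i`. Since
      -- `S_N ≥ 0` there, replacing `c` by `u j ≥ c` only helps.
      obtain ⟨φ, hφ, hK⟩ := extraction_forall_of_frequently fun i : ℕ =>
        (ha2 i).and_eventually ((hs.eventually_ge_atTop 0).and (eventually_ge_atTop 1))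
      refine h.blockProd_cond_image_eq_zero hW hW0 hWt hφ.tendsto_atTop ?_ hCm hCf
      have h1 : Tendsto (fun i : ℕ => ENNReal.ofReal (Real.exp (-(i : ℝ) + a 0 * Real.log 2)) *
          (ENNReal.ofReal m)⁻¹) atTop (𝓝 0) := by
        have h2 := ENNReal.tendsto_ofReal (Real.tendsto_exp_atBot.comp
          (tendsto_atBot_add_const_right _ (a 0 * Real.log 2)
            (tendsto_neg_atTop_atBot.comp (tendsto_natCast_atTop_atTop (R := ℝ)))))
        have h3 := ENNReal.Tendsto.mul_const h2 (Or.inr (ENNReal.inv_ne_top.2 hmpos))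
        simpa using h3
      refine tendsto_of_tendsto_of_tendsto_of_le_of_le tendsto_const_nhds h1
        (fun _ => bot_le) fun i => ?_
      obtain ⟨h2, h3, h4⟩ := hK i
      dsimp only
      rw [hWprod _ h4, ENNReal.mul_inv (Or.inl (ofReal_exp_ne_zero _))
        (Or.inl ENNReal.ofReal_ne_top), ← ENNReal.ofReal_inv_of_pos (Real.exp_pos _),
        ← Real.exp_neg, mul_right_comm, ofReal_exp_mul_ofReal_exp]
      gcongr ENNReal.ofReal (Real.exp ?_) * _
      nlinarith [mul_nonneg (sub_nonneg.2 hu) h3]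
    set G := rectangle α W \ ⋃ j ∈ Finset.range n, Φ (T - u j) '' C j with hG
    have hGm : MeasurableSet G := hWm.diff <| Finset.measurableSet_biUnion _ fun j hj =>
      h.measurableSet_image _ (hC j (Finset.mem_range.1 hj)).2.1
    have hGnull : PW Gᶜ = 0 := by
      have e : Gᶜ = (rectangle α W)ᶜ ∪ ⋃ j ∈ Finset.range n, Φ (T - u j) '' C j := by
        rw [hG, Set.sdiff_eq, compl_inter, compl_compl]
      rw [e, measure_union_null_iff, prob_compl_eq_zero_iff hWm]
      exact ⟨blockProd_rectangle_eq_one _ hW fun k => hcond k _ (hW k) (hW0 k) (hWt k),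
        measure_iUnion_null fun j => measure_iUnion_null fun hj =>
          hnull j (Finset.mem_range.1 hj)⟩
    -- As `PW` is the convolution of the law of the shifts with `PB`, Fubini shows that almost every
    -- shift `v` moves `PB`-almost all of `B` into `G`.
    obtain ⟨v, hv⟩ : ∃ v, PB ((fun y => v + y) ⁻¹' Gᶜ) = 0 := by
      rw [← hPWc, Measure.conv, Measure.map_apply measurable_add hGm.compl,
        Measure.measure_prod_null (measurable_add hGm.compl)] at hGnull
      exact hGnull.exists
    set X := rectangle α B ∩ (fun y => v + y) ⁻¹' G with hX
    have hBm := measurableSet_rectangle hB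
    have hXm : MeasurableSet X := hBm.inter (measurable_const_add v hGm)
    have hPX : PB X = 1 := by
      rw [← prob_compl_eq_zero_iff hXm, hX, compl_inter, measure_union_null_iff,
        prob_compl_eq_zero_iff hBm]
      exact ⟨blockProd_rectangle_eq_one _ hB fun k => hcond k _ (hB k) (hB0 k) (hBt k), hv⟩
    have hXG : (fun y => v + y) '' X ⊆ G := image_subset_iff.2 inter_subset_right
    refine ⟨(fun y => v + y) '' X, ?_, ?_, fun j hj => ?_, ?_⟩
    · rw [image_add_left]
      exact measurable_const_add _ hXm
    · rw [h.image_image, add_neg_cancel, h.image_zero]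
      exact hXG.trans sdiff_subset
    · refine Disjoint.mono_left hXG (disjoint_sdiff_left.mono_right ?_)
      exact subset_biUnion_of_mem (u := fun j => Φ (T - u j) '' C j)
        (by simpa using hj : j ∈ (Finset.range n : Set ℕ))
    · rw [(ordinaryLebesgue_isOrdinaryLebesgueMeasure α).1 v X hXm]
      refine le_antisymm ?_ ?_
      · rw [← ordinaryLebesgue_rectangle hBord]
        exact measure_mono inter_subset_left
      -- Full probability in `B` means full measure `m`.
      · simpa [hPX, ← hPB] using mul_blockProd_cond_le hBord hmpos hXm

/-- Earlier choices, transported to time `t k`, are all that can be missing. This reduces each later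
demand to the removal problem solved by a reservoir. -/
theorem sdiff_subset_offeredSet {τ : Set (Set (ℕ → ℝ)) → Set (ℕ → ℝ)} {ν : Measure (ℕ → ℝ)}
    {t m : ℕ → ℝ} {Y : Set (ℕ → ℝ)} (k : ℕ) :
    Φ (t k) '' Y \ ⋃ j ∈ Finset.range k, Φ (t k - t j) ''
      τ (demandFamily ν (offeredSet τ ν Φ t m Y j) (m j)) ⊆ offeredSet τ ν Φ t m Y k := by
  induction k with
  | zero => exact sdiff_subset
  | succ k ih =>
    rintro _ ⟨⟨y, hy, rfl⟩, hx⟩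
    have e : ∀ X, Φ (t (k + 1) - t k) '' (Φ (t k) '' X) = Φ (t (k + 1)) '' X := fun X => by
      rw [h.image_image, sub_add_cancel]
    have e' : Φ (t (k + 1)) y = Φ (t (k + 1) - t k) (Φ (t k) y) := by
      rw [← h.add, sub_add_cancel]
    simp only [mem_iUnion, Finset.mem_range, not_exists] at hx
    rw [offeredSet, e']
    refine mem_image_of_mem _ ⟨ih ⟨mem_image_of_mem _ hy, ?_⟩, fun hk => ?_⟩
    · simp only [mem_iUnion, Finset.mem_range, not_exists]
      intro j hj hyj
      refine hx j (by omega) ?_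
      rw [e', show t (k + 1) - t j = (t (k + 1) - t k) + (t k - t j) by ring, ← h.image_image]
      exact mem_image_of_mem _ hyj
    · refine hx k (by omega) ?_
      rw [e']
      exact mem_image_of_mem _ hk

/-- If the volumes are expanded without bound, then the demands are satisfied from initial systems
of arbitrarily small measure. -/
theorem exists_demandsSatisfied
    (hs : Tendsto (fun N => ∑ k ∈ Finset.range N, ρ k) atTop atTop)
    {τ : Set (Set (ℕ → ℝ)) → Set (ℕ → ℝ)} (hτ : IsChoiceOperator τ) {n : ℕ}
    {t m : ℕ → ℝ} (ht0 : 0 < t 0) (ht : ∀ k < n, t 0 ≤ t k) (hm : ∀ k < n, 0 < m k)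
    {ε : ℝ} (hε : 0 < ε) :
    ∃ Y, MeasurableSet Y ∧ ordinaryLebesgue α Y = ENNReal.ofReal ε ∧
      DemandsSatisfied τ (ordinaryLebesgue α) Φ n t m Y := by
  have hres := fun (i : ℕ) (hi : i < n) => h.exists_reservoir hs ht0 (ht i hi) (hm i hi)
  choose! D hDm hD0 hD using hres
  obtain ⟨E, hE⟩ := exists_isOrdinaryRectangle α hε
  have hEm := measurableSet_rectangle hE.1
  set U := ⋃ i ∈ Finset.range n, D i with hU
  have hUm : MeasurableSet U :=
    Finset.measurableSet_biUnion _ fun i hi => hDm i (Finset.mem_range.1 hi)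
  have hU0 : ordinaryLebesgue α U = 0 :=
    measure_iUnion_null fun i => measure_iUnion_null fun hi => hD0 i (Finset.mem_range.1 hi)
  -- The null reservoirs, one per consumer, meet the demands; the rectangle `E` only gives the
  -- system its positive measure `ε`.
  refine ⟨U ∪ rectangle α E, hUm.union hEm, ?_, fun k => ?_⟩
  · rw [← ordinaryLebesgue_rectangle hE]
    refine le_antisymm ((measure_union_le _ _).trans ?_) (measure_mono subset_union_right)
    rw [hU0, zero_add]
  induction k using Nat.strong_induction_on with
  | _ k ih =>
  intro hk
  set Y := U ∪ rectangle α E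
  obtain ⟨X, hXm, hXD, hXdis, hXv⟩ := hD k hk k t
    (fun j => τ (demandFamily (ordinaryLebesgue α)
      (offeredSet τ (ordinaryLebesgue α) Φ t m Y j) (m j))) (fun j hj => by
        obtain ⟨h1, -, h2⟩ := hτ _ (ih j hj (hj.trans hk))
        exact ⟨ht j (hj.trans hk), h1, by rw [h2]; exact ENNReal.ofReal_ne_top⟩)
  refine ⟨X, hXm, Subset.trans ?_ (h.sdiff_subset_offeredSet k), hXv⟩
  refine subset_sdiff.2 ⟨hXD.trans (image_mono ?_), ?_⟩
  · exact (subset_biUnion_of_mem (u := D)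
      (by simpa using hk : k ∈ (Finset.range n : Set ℕ))).trans subset_union_left
  · simp only [disjoint_iUnion_right, Finset.mem_range]
    exact hXdis

end IsBlockScaling

/-! ### The Fourier flow in complex coordinates -/

theorem sum_range_eq_even_add_odd {M : Type*} [AddCommMonoid M] (f : ℕ → M) (N : ℕ) :
    ∑ n ∈ Finset.range N, f n = ∑ j ∈ Finset.range ((N + 1) / 2), f (2 * j) +
      ∑ j ∈ Finset.range (N / 2), f (2 * j + 1) := by
  induction N with
  | zero => simp
  | succ N ih =>
    rw [Finset.sum_range_succ, ih]
    rcases Nat.even_or_odd' N with ⟨M, rfl | rfl⟩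
    · rw [show (2 * M + 1 + 1) / 2 = M + 1 by omega, show (2 * M + 1) / 2 = M by omega,
        show 2 * M / 2 = M by omega, Finset.sum_range_succ]
      exact add_right_comm _ _ _
    · rw [show (2 * M + 1 + 1 + 1) / 2 = M + 1 by omega, show (2 * M + 1 + 1) / 2 = M + 1 by omega,
        show (2 * M + 1) / 2 = M by omega, Finset.sum_range_succ (fun j => f (2 * j + 1)), add_assoc]

/-- Even powers of `-i x` are real and odd ones imaginary, so the partial sums interleave those of
the two given series. No absolute convergence is needed. -/
theorem tendsto_sum_mul_pow {A : ℕ → ℝ} {x s w : ℝ}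
    (hs : Tendsto (fun N : ℕ => ∑ j ∈ Finset.range N,
      (-1 : ℝ) ^ j * A (2 * j) * x ^ (2 * j)) atTop (𝓝 s))
    (hw : Tendsto (fun N : ℕ => ∑ j ∈ Finset.range N,
      (-1 : ℝ) ^ j * A (2 * j + 1) * x ^ (2 * j + 1)) atTop (𝓝 w)) :
    Tendsto (fun N => ∑ n ∈ Finset.range N, (A n : ℂ) * (-(Complex.I * x)) ^ n) atTop
      (𝓝 (s - Complex.I * w)) := by
  have hI : ∀ j : ℕ, (-(Complex.I * (x : ℂ))) ^ (2 * j) = (-1) ^ j * (x : ℂ) ^ (2 * j) := by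
    intro j
    rw [pow_mul, neg_sq, mul_pow, Complex.I_sq, mul_pow, ← pow_mul]
  have h1 : Tendsto (fun N : ℕ => (N + 1) / 2) atTop atTop :=
    tendsto_atTop.2 fun b => by
      filter_upwards [eventually_ge_atTop (2 * b)] with N hN
      omega
  have h2 : Tendsto (fun N : ℕ => N / 2) atTop atTop :=
    tendsto_atTop.2 fun b => by
      filter_upwards [eventually_ge_atTop (2 * b)] with N hN
      omega
  have h3 := ((Complex.continuous_ofReal.tendsto _).comp (hs.comp h1)).sub
    (((Complex.continuous_ofReal.tendsto _).comp (hw.comp h2)).const_mul Complex.I)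
  refine h3.congr fun N => ?_
  rw [sum_range_eq_even_add_odd]
  simp only [Function.comp, Complex.ofReal_sum, Finset.mul_sum, sub_eq_add_neg,
    ← Finset.sum_neg_distrib]
  congr 1
  · refine Finset.sum_congr rfl fun j _ => ?_
    rw [hI]
    push_cast
    ring
  · refine Finset.sum_congr rfl fun j _ => ?_
    rw [pow_succ (-(Complex.I * (x : ℂ))), hI]
    push_cast
    ring

/-- The pair `(aₖ, bₖ)`, `k = j + 1`, as a complex number. -/
def pairAt (j : ℕ) (a : ℕ → ℝ) : ℂ := ⟨a (2 * j + 1), a (2 * j + 2)⟩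

theorem pairAt_fourierDeriv (l : ℝ) (j : ℕ) (a : ℕ → ℝ) :
    pairAt j (fourierDeriv l a) =
      -(Complex.I * (((j + 1 : ℕ) : ℝ) * Real.pi / l : ℝ)) * pairAt j a := by
  have h1 : fourierDeriv l a (2 * j + 1) = ((j + 1 : ℕ) : ℝ) * Real.pi / l * a (2 * j + 2) := by
    simp only [fourierDeriv, LinearMap.coe_mk, AddHom.coe_mk]
    rw [if_neg (by omega), if_pos (by omega), show (2 * j + 1 + 1) / 2 = j + 1 by omega]
  have h2 : fourierDeriv l a (2 * j + 2) =
      -(((j + 1 : ℕ) : ℝ) * Real.pi / l) * a (2 * j + 1) := by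
    simp only [fourierDeriv, LinearMap.coe_mk, AddHom.coe_mk]
    rw [if_neg (by omega), if_neg (by omega), show (2 * j + 2) / 2 = j + 1 by omega,
      show 2 * j + 2 - 1 = 2 * j + 1 by omega]
  apply Complex.ext
  · simp only [pairAt, h1, Complex.mul_re, Complex.neg_re, Complex.neg_im, Complex.I_re,
      Complex.I_im, Complex.mul_im, Complex.ofReal_re, Complex.ofReal_im]
    ring
  · simp only [pairAt, h2, Complex.mul_re, Complex.neg_re, Complex.neg_im, Complex.I_re,
      Complex.I_im, Complex.mul_im, Complex.ofReal_re, Complex.ofReal_im]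
    ring

theorem pairAt_fourierDeriv_pow (l : ℝ) (j n : ℕ) (a : ℕ → ℝ) :
    pairAt j ((fourierDeriv l ^ n) a) =
      (-(Complex.I * (((j + 1 : ℕ) : ℝ) * Real.pi / l : ℝ))) ^ n * pairAt j a := by
  induction n with
  | zero => simp
  | succ n ih =>
    rw [pow_succ', Module.End.mul_apply, pairAt_fourierDeriv, ih, pow_succ', mul_assoc]

theorem fourierGenerator_zero_coord (l : ℝ) (A a : ℕ → ℝ) :
    fourierGenerator l A a 0 = A 0 * a 0 := by
  refine Tendsto.limUnder_eq (tendsto_const_nhds.congr' ?_)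
  filter_upwards [eventually_ge_atTop 1] with N hN
  rw [Finset.sum_eq_single 0]
  · simp
  · intro n _ hn
    obtain ⟨n, rfl⟩ := Nat.exists_eq_succ_of_ne_zero hn
    rw [pow_succ', Module.End.mul_apply]
    simp [fourierDeriv]
  · simp; omega

theorem pairAt_fourierGenerator {l : ℝ} {A : ℕ → ℝ} {j : ℕ} {s w : ℝ}
    (hs : Tendsto (fun N : ℕ => ∑ i ∈ Finset.range N,
      (-1 : ℝ) ^ i * A (2 * i) * (((j + 1 : ℕ) : ℝ) * Real.pi / l) ^ (2 * i)) atTop (𝓝 s))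
    (hw : Tendsto (fun N : ℕ => ∑ i ∈ Finset.range N,
      (-1 : ℝ) ^ i * A (2 * i + 1) * (((j + 1 : ℕ) : ℝ) * Real.pi / l) ^ (2 * i + 1))
      atTop (𝓝 w)) (a : ℕ → ℝ) :
    pairAt j (fourierGenerator l A a) = (s - Complex.I * w) * pairAt j a := by
  have h := (tendsto_sum_mul_pow hs hw).mul_const (pairAt j a)
  have h1 : ∀ N, (∑ n ∈ Finset.range N,
      (A n : ℂ) * (-(Complex.I * (((j + 1 : ℕ) : ℝ) * Real.pi / l : ℝ))) ^ n) * pairAt j a =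
      ∑ n ∈ Finset.range N, (A n : ℂ) * pairAt j ((fourierDeriv l ^ n) a) := fun N => by
    rw [Finset.sum_mul]
    refine Finset.sum_congr rfl fun n _ => ?_
    rw [pairAt_fourierDeriv_pow, mul_assoc]
  simp only [h1] at h
  apply Complex.ext
  · refine Tendsto.limUnder_eq (((Complex.continuous_re.tendsto _).comp h).congr fun N => ?_)
    simp [pairAt]
  · refine Tendsto.limUnder_eq (((Complex.continuous_im.tendsto _).comp h).congr fun N => ?_)
    simp [pairAt]

/-- The sequence with prescribed first coordinate and prescribed pairs. -/
noncomputable def ofPairs (x : ℝ) (z : ℕ → ℂ) (i : ℕ) : ℝ :=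
  if i = 0 then x else if i % 2 = 1 then (z (i / 2)).re else (z (i / 2 - 1)).im

@[simp]
theorem ofPairs_zero (x : ℝ) (z : ℕ → ℂ) : ofPairs x z 0 = x := rfl

@[simp]
theorem ofPairs_odd (x : ℝ) (z : ℕ → ℂ) (j : ℕ) : ofPairs x z (2 * j + 1) = (z j).re := by
  rw [ofPairs, if_neg (by omega), if_pos (by omega), show (2 * j + 1) / 2 = j by omega]

@[simp]
theorem ofPairs_even (x : ℝ) (z : ℕ → ℂ) (j : ℕ) : ofPairs x z (2 * j + 2) = (z j).im := by
  rw [ofPairs, if_neg (by omega), if_neg (by omega), show (2 * j + 2) / 2 - 1 = j by omega]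

theorem forall_coord {p : ℕ → Prop} : (∀ i, p i) ↔ p 0 ∧ ∀ j, p (2 * j + 1) ∧ p (2 * j + 2) := by
  refine ⟨fun h => ⟨h 0, fun j => ⟨h _, h _⟩⟩, fun h i => ?_⟩
  rcases Nat.even_or_odd' i with ⟨j, rfl | rfl⟩
  · rcases j with _ | j
    · exact h.1
    · exact (h.2 j).2
  · exact (h.2 j).1

/-- The generator is diagonal in these coordinates, so the coordinatewise exponential series is the
scalar one in each of them. -/
theorem fourierFlow_eq_ofPairs {l : ℝ} {A σ ω : ℕ → ℝ}
    (hgen : ∀ j a, pairAt j (fourierGenerator l A a) =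
      (σ (j + 1) - Complex.I * ω (j + 1)) * pairAt j a) (t : ℝ) (a : ℕ → ℝ) :
    fourierFlow l A t a = ofPairs (Real.exp (t * A 0) * a 0) fun j =>
      Complex.exp (t * (σ (j + 1) - Complex.I * ω (j + 1))) * pairAt j a := by
  have hit0 : ∀ p, (fourierGenerator l A)^[p] a 0 = A 0 ^ p * a 0 := by
    intro p
    induction p with
    | zero => simp
    | succ p ih =>
      rw [Function.iterate_succ_apply', fourierGenerator_zero_coord, ih, pow_succ', mul_assoc]
  have hit : ∀ j p, pairAt j ((fourierGenerator l A)^[p] a) =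
      (σ (j + 1) - Complex.I * ω (j + 1)) ^ p * pairAt j a := by
    intro j p
    induction p with
    | zero => simp
    | succ p ih =>
      rw [Function.iterate_succ_apply', hgen, ih, pow_succ', mul_assoc]
  have h0 : HasSum (fun p : ℕ => t ^ p / (p.factorial : ℝ) * (fourierGenerator l A)^[p] a 0)
      (Real.exp (t * A 0) * a 0) := by
    have := (NormedSpace.expSeries_div_hasSum_exp (t * A 0)).mul_right (a 0)
    rw [← Real.exp_eq_exp_ℝ] at this
    refine this.congr_fun fun p => ?_
    rw [hit0, mul_pow]
    ring
  have h1 : ∀ j, HasSum (fun p : ℕ => ((t ^ p / (p.factorial : ℝ) : ℝ) : ℂ) *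
      pairAt j ((fourierGenerator l A)^[p] a))
      (Complex.exp (t * (σ (j + 1) - Complex.I * ω (j + 1))) * pairAt j a) := by
    intro j
    have := (NormedSpace.expSeries_div_hasSum_exp
      (t * (σ (j + 1) - Complex.I * ω (j + 1)) : ℂ)).mul_right (pairAt j a)
    rw [← Complex.exp_eq_exp_ℂ] at this
    refine this.congr_fun fun p => ?_
    rw [hit, mul_pow]
    push_cast
    ring
  refine HasSum.tsum_eq (Pi.hasSum.2 (forall_coord.2 ⟨?_, fun j => ⟨?_, ?_⟩⟩))
  · simpa using h0
  · have := Complex.hasSum_re (h1 j)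
    simp only [Complex.re_ofReal_mul] at this
    simpa [pairAt] using this
  · have := Complex.hasSum_im (h1 j)
    simp only [Complex.im_ofReal_mul] at this
    simpa [pairAt] using this

theorem pairAt_ofPairs (x : ℝ) (z : ℕ → ℂ) (j : ℕ) : pairAt j (ofPairs x z) = z j := by
  apply Complex.ext <;> simp [pairAt]

theorem ofPairs_pairAt (a : ℕ → ℝ) : ofPairs (a 0) (fun j => pairAt j a) = a :=
  funext (forall_coord.2 ⟨rfl, fun j => ⟨by simp [pairAt], by simp [pairAt]⟩⟩)

theorem blockStart_oneTwoTwo (j : ℕ) : blockStart oneTwoTwo (j + 1) = 2 * j + 1 := by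
  induction j with
  | zero => simp [blockStart, oneTwoTwo]
  | succ j ih =>
    rw [blockStart, Finset.sum_range_succ, ← blockStart, ih]
    simp [oneTwoTwo]
    ring

/-- Multiplication by a complex number on the plane. -/
theorem exists_linearMap_mul_complex {d : ℕ} (hd : d = 2) (w : ℂ) :
    ∃ G : (Fin d → ℝ) →ₗ[ℝ] (Fin d → ℝ), LinearMap.det G = Complex.normSq w ∧
      ∀ a b : ℕ → ℝ, (⟨b 0, b 1⟩ : ℂ) = w * ⟨a 0, a 1⟩ →
        (fun i : Fin d => b i) = G fun i : Fin d => a i := by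
  subst hd
  refine ⟨Matrix.toLin' !![w.re, -w.im; w.im, w.re], ?_, fun a b hab => ?_⟩
  · rw [LinearMap.det_toLin', Matrix.det_fin_two_of, Complex.normSq_apply]
    ring
  · have h1 := congrArg Complex.re hab
    have h2 := congrArg Complex.im hab
    simp only [Complex.mul_re, Complex.mul_im] at h1 h2
    ext i
    fin_cases i
    · simp [Matrix.vecHead, Matrix.vecTail, h1]
      ring
    · simp [Matrix.vecHead, Matrix.vecTail, h2]
      ring

/-- A linear flow acts on blocks through linear maps with exponential determinants. -/
theorem exists_linearMap_block_ofPairs (A σ ω : ℕ → ℝ) (t : ℝ) (k : ℕ) :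
    ∃ G : (Fin (oneTwoTwo k) → ℝ) →ₗ[ℝ] (Fin (oneTwoTwo k) → ℝ),
      LinearMap.det G = Real.exp (t * if k = 0 then A 0 else 2 * σ k) ∧
      ∀ a : ℕ → ℝ, block oneTwoTwo k (ofPairs (Real.exp (t * A 0) * a 0) fun j =>
        Complex.exp (t * (σ (j + 1) - Complex.I * ω (j + 1))) * pairAt j a) =
        G (block oneTwoTwo k a) := by
  rcases k with _ | j
  · refine ⟨Real.exp (t * A 0) • LinearMap.id, ?_, fun a => ?_⟩
    · rw [LinearMap.det_smul, LinearMap.det_id, Module.finrank_fin_fun]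
      simp [oneTwoTwo]
    · ext i
      have hi : (i : ℕ) = 0 := by
        have := i.2
        simp only [oneTwoTwo, if_true, PNat.one_coe] at this
        omega
      simp [block, blockStart, hi]
  · obtain ⟨G, hdet, hG⟩ := exists_linearMap_mul_complex (d := oneTwoTwo (j + 1))
      (by simp [oneTwoTwo]) (Complex.exp (t * (σ (j + 1) - Complex.I * ω (j + 1))))
    refine ⟨G, ?_, fun a => ?_⟩
    -- The determinant is `|exp (t (σ - i ω))| ^ 2 = exp (2 t σ)`: `ω` only rotates, and the square
    -- produces the factor `2` in `S_N`.
    · rw [hdet, Complex.normSq_eq_norm_sq, Complex.norm_exp, ← Real.exp_nat_mul,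
        if_neg (Nat.succ_ne_zero j)]
      congr 1
      simp
      ring
    · refine hG (fun i => a (blockStart oneTwoTwo (j + 1) + i))
        (fun i => ofPairs _ _ (blockStart oneTwoTwo (j + 1) + i)) ?_
      simp only [blockStart_oneTwoTwo, add_zero, add_assoc, Nat.reduceAdd]
      exact pairAt_ofPairs _ _ j

theorem isBlockScaling_fourierFlow {l : ℝ} {A σ ω : ℕ → ℝ}
    (hσ : ∀ k : ℕ, 1 ≤ k → Tendsto
      (fun N : ℕ => ∑ j ∈ Finset.range N,
        (-1 : ℝ) ^ j * A (2 * j) * ((k : ℝ) * Real.pi / l) ^ (2 * j)) atTop (𝓝 (σ k)))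
    (hω : ∀ k : ℕ, 1 ≤ k → Tendsto
      (fun N : ℕ => ∑ j ∈ Finset.range N,
        (-1 : ℝ) ^ j * A (2 * j + 1) * ((k : ℝ) * Real.pi / l) ^ (2 * j + 1)) atTop (𝓝 (ω k))) :
    IsBlockScaling oneTwoTwo (fun k => if k = 0 then A 0 else 2 * σ k) (fourierFlow l A) := by
  have hflow := fourierFlow_eq_ofPairs (l := l) (A := A) (σ := σ) (ω := ω) fun j a =>
    pairAt_fourierGenerator (hσ (j + 1) (by omega)) (hω (j + 1) (by omega)) a
  have hzero : ∀ x, fourierFlow l A 0 x = x := fun x => by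
    rw [hflow]
    simpa using ofPairs_pairAt x
  have hadd : ∀ s t x, fourierFlow l A (s + t) x = fourierFlow l A s (fourierFlow l A t x) := by
    intro s t x
    simp only [hflow, pairAt_ofPairs, ofPairs_zero, ← mul_assoc, ← Real.exp_add,
      ← Complex.exp_add, Complex.ofReal_add, ← add_mul]
  have hneg : ∀ t x, fourierFlow l A (-t) (fourierFlow l A t x) = x := fun t x => by
    rw [← hadd, neg_add_cancel, hzero]
  refine ⟨hzero, hadd, fun t => ?_, fun t R hR => ?_⟩
  · rw [funext (hflow t)]
    refine measurable_pi_lambda _ fun i => ?_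
    revert i
    have hp : ∀ j, Measurable (pairAt j) := fun j => by
      have : pairAt j = fun a => (a (2 * j + 1) : ℂ) + a (2 * j + 2) * Complex.I :=
        funext fun a => Complex.mk_eq_add_mul_I _ _
      rw [this]
      fun_prop
    refine forall_coord.2 ⟨?_, fun j => ⟨?_, ?_⟩⟩
    · simp only [ofPairs_zero]
      exact (measurable_pi_apply 0).const_mul _
    · simp only [ofPairs_odd]
      exact Complex.measurable_re.comp ((hp j).const_mul _)
    · simp only [ofPairs_even]
      exact Complex.measurable_im.comp ((hp j).const_mul _)
  -- The image under time `t` is the preimage under time `-t`; the preimage under a map of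
  -- determinant `exp (-t ρ k)` has its volume multiplied by `exp (t ρ k)`.
  · choose G hdet hG using exists_linearMap_block_ofPairs A σ ω (-t)
    refine ⟨fun k => G k ⁻¹' R k, fun k => ?_, fun k => ?_, ?_⟩
    · exact (G k).continuous_of_finiteDimensional.measurable (hR k)
    · rw [Measure.addHaar_preimage_linearMap _ (by rw [hdet]; exact (Real.exp_pos _).ne'), hdet,
        ← Real.exp_neg, abs_of_pos (Real.exp_pos _), neg_mul, neg_neg]
    · rw [image_eq_preimage_of_inverse (hneg t) fun x => by simpa using hneg (-t) x]
      ext x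
      simp only [mem_preimage, rectangle, mem_ofPred_eq, hflow (-t) x, hG]

theorem sum_range_succ_ite (x : ℝ) (σ : ℕ → ℝ) (N : ℕ) :
    ∑ k ∈ Finset.range (N + 1), (if k = 0 then x else 2 * σ k) =
      x + 2 * ∑ k ∈ Finset.Icc 1 N, σ k := by
  induction N with
  | zero => simp
  | succ N ih =>
    rw [Finset.sum_range_succ, ih, Finset.sum_Icc_succ_top (by omega), if_neg (Nat.succ_ne_zero N)]
    ring

/-! ### Convergence criteria and conclusion -/

namespace IsBlockScaling

variable {α : ℕ → ℕ+} {ρ : ℕ → ℝ} {Φ : ℝ → (ℕ → ℝ) → ℕ → ℝ} (h : IsBlockScaling α ρ Φ)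
include h

/-- If every set of positive finite measure is mapped to such a set, then the logarithms of the
scaling factors of the finite-dimensional volumes converge. -/
theorem tendsto_of_measure_image (H : ∀ D, MeasurableSet D → 0 < ordinaryLebesgue α D →
      ordinaryLebesgue α D < ∞ →
      ordinaryLebesgue α (Φ 1 '' D) ≠ 0 ∧ ordinaryLebesgue α (Φ 1 '' D) ≠ ∞) :
    ∃ S, Tendsto (fun N => ∑ k ∈ Finset.range N, ρ k) atTop (𝓝 S) := by
  obtain ⟨R, hR⟩ := exists_isOrdinaryRectangle α one_pos
  have hRm := measurableSet_rectangle hR.1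
  have hRv := ordinaryLebesgue_rectangle hR
  obtain ⟨h0, ht⟩ := H _ hRm (by simp [hRv]) (by simp [hRv])
  obtain ⟨R', hm, hv, e⟩ := h.image_rectangle 1 R hR.1
  have hR0 := hR.volume_ne_zero (by simp)
  have hRt := hR.volume_ne_top hR0
  rw [e] at h0 ht
  have hR' := isOrdinaryRectangle_of_measure_ne_top hm
    (fun k => by rw [hv]; exact mul_ne_zero (ofReal_exp_ne_zero _) (hR0 k))
    (fun k => by rw [hv]; exact ENNReal.mul_ne_top ENNReal.ofReal_ne_top (hRt k)) ht
  have h1 := ENNReal.Tendsto.mul hR'.2.2 (Or.inl h0) (tendsto_inv_iff.2 hR.2.2)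
    (Or.inl (by simp))
  have h2 := h1.congr fun N => show _ = ENNReal.ofReal
      (Real.exp (1 * ∑ k ∈ Finset.range N, ρ k)) by
    simp only [hv]
    rw [prod_ofReal_exp_mul, mul_assoc, ENNReal.mul_inv_cancel
      (Finset.prod_ne_zero_iff.2 fun k _ => hR0 k) (ENNReal.prod_ne_top fun k _ => hRt k), mul_one]
  rw [ENNReal.ofReal_one, inv_one, mul_one] at h2
  have h3 := (Real.continuousAt_log (ENNReal.toReal_pos h0 ht).ne').tendsto.comp
    ((ENNReal.tendsto_toReal ht).comp h2)
  refine ⟨_, h3.congr fun N => ?_⟩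
  simp only [Function.comp, ENNReal.toReal_ofReal (Real.exp_pos _).le, Real.log_exp, one_mul]

/-- A minimiser would meet the first demand from finite measure, leaving only `S_N → +∞`; but then
an initial system of measure `M / 2` also satisfies all demands. -/
theorem not_isSPCDSolution (hS : ¬ ∃ S, Tendsto (fun N => ∑ k ∈ Finset.range N, ρ k) atTop (𝓝 S))
    {τ : Set (Set (ℕ → ℝ)) → Set (ℕ → ℝ)} (hτ : IsChoiceOperator τ) {n : ℕ} (hn : 1 ≤ n)
    {t m : ℕ → ℝ} (ht0 : 0 < t 0) (ht : ∀ k < n, t 0 ≤ t k) (hm : ∀ k < n, 0 < m k) :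
    ¬ ∃ M : ℝ, IsSPCDSolution τ (ordinaryLebesgue α) Φ n t m M := by
  rintro ⟨M, ⟨Y, hY, hY0, hYd, hYM⟩, hmin⟩
  have hM : 0 < M := by
    rw [hYM] at hY0
    simpa using hY0
  obtain ⟨C, hC, hCY, hCv⟩ := hYd 0 hn
  obtain ⟨L, hL, hlim⟩ := h.exists_tendsto_exp hY (by simp [hYM]) hC hCY
    (by rw [hCv]; simpa using hm 0 hn) (by simp [hCv])
  rcases tendsto_of_tendsto_ofReal_exp hL ht0 hlim with hs | hs
  · obtain ⟨Y', hY', hYv, hYd'⟩ := h.exists_demandsSatisfied hs hτ ht0 ht hm (half_pos hM)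
    have := hmin ⟨Y', hY', by rw [hYv]; simpa using hM, hYd', hYv⟩
    rw [ENNReal.ofReal_le_ofReal_iff (half_pos hM).le] at this
    linarith
  · exact hS hs

end IsBlockScaling

theorem mainTheorem2
    (l : ℝ) (hl : l ≠ 0) (A σ ω : ℕ → ℝ)
    (hσ : ∀ k : ℕ, 1 ≤ k → Tendsto
      (fun N : ℕ => ∑ j ∈ Finset.range N,
        (-1 : ℝ) ^ j * A (2 * j) * ((k : ℝ) * Real.pi / l) ^ (2 * j)) atTop (𝓝 (σ k)))
    (hω : ∀ k : ℕ, 1 ≤ k → Tendsto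
      (fun N : ℕ => ∑ j ∈ Finset.range N,
        (-1 : ℝ) ^ j * A (2 * j + 1) * ((k : ℝ) * Real.pi / l) ^ (2 * j + 1)) atTop (𝓝 (ω k)))
    (τ : Set (Set (ℕ → ℝ)) → Set (ℕ → ℝ)) (hτ : IsChoiceOperator τ)
    (n : ℕ) (hn : 1 ≤ n) (t m : ℕ → ℝ)
    (ht : ∀ k : ℕ, k + 1 < n → t k < t (k + 1)) (hm : ∀ k < n, 0 < m k) :
    (∀ S : ℝ,
      Tendsto (fun N : ℕ => A 0 + 2 * ∑ k ∈ Finset.Icc 1 N, σ k) atTop (𝓝 S) →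
      IsSPCDSolution τ (ordinaryLebesgue oneTwoTwo) (fourierFlow l A) n t m
        (∑ k ∈ Finset.range n, m k * Real.exp (-t k * S)) ∧
      ∀ Y : Set (ℕ → ℝ), MeasurableSet Y →
        ordinaryLebesgue oneTwoTwo Y =
          ENNReal.ofReal (∑ k ∈ Finset.range n, m k * Real.exp (-t k * S)) →
        DemandsSatisfied τ (ordinaryLebesgue oneTwoTwo) (fourierFlow l A) n t m Y) ∧
    (IsStableFlow (ordinaryLebesgue oneTwoTwo) (fourierFlow l A) ∨
        IsExpansibleFlow (ordinaryLebesgue oneTwoTwo) (fourierFlow l A) ∨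
        IsPressingFlow (ordinaryLebesgue oneTwoTwo) (fourierFlow l A) →
      ∃ M : ℝ, IsSPCDSolution τ (ordinaryLebesgue oneTwoTwo) (fourierFlow l A) n t m M) ∧
    (0 < t 0 →
      IsTotallyPressingFlow (ordinaryLebesgue oneTwoTwo) (fourierFlow l A) ∨
        IsTotallyExpansibleFlow (ordinaryLebesgue oneTwoTwo) (fourierFlow l A) ∨
        Tendsto (fun N : ℕ => A 0 + 2 * ∑ k ∈ Finset.Icc 1 N, σ k) atTop atBot ∨
        Tendsto (fun N : ℕ => A 0 + 2 * ∑ k ∈ Finset.Icc 1 N, σ k) atTop atTop →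
      ¬ ∃ M : ℝ, IsSPCDSolution τ (ordinaryLebesgue oneTwoTwo) (fourierFlow l A) n t m M) := by
  have hbs := isBlockScaling_fourierFlow hσ hω
  set ρ : ℕ → ℝ := fun k => if k = 0 then A 0 else 2 * σ k
  have hiff : ∀ F : Filter ℝ,
      Tendsto (fun N : ℕ => A 0 + 2 * ∑ k ∈ Finset.Icc 1 N, σ k) atTop F ↔
        Tendsto (fun N => ∑ k ∈ Finset.range N, ρ k) atTop F := fun F => by
    rw [← tendsto_add_atTop_iff_nat (f := fun N => ∑ k ∈ Finset.range N, ρ k) 1]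
    simp only [ρ, sum_range_succ_ite]
  have ht0 : ∀ k < n, t 0 ≤ t k := by
    intro k
    induction k with
    | zero => exact fun _ => le_rfl
    | succ k ih => exact fun hk => (ih (by omega)).trans (ht k hk).le
  refine ⟨fun S hS => hbs.isSPCDSolution ((hiff _).1 hS) hτ hn hm, fun hflow => ?_,
    fun htpos hflow => ?_⟩
  · obtain ⟨S, hS⟩ := hbs.tendsto_of_measure_image fun D hD hD0 hDt => by
      rcases hflow with hf | hf | hf
      · rw [hf 1 one_pos D hD hD0 hDt]
        exact ⟨hD0.ne', hDt.ne⟩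
      -- Strict inequalities against the times `1 / 2` and `2` exclude the values `0` and `∞` at
      -- time `1`.
      · exact ⟨(hf (1 / 2) 1 (by norm_num) (by norm_num) D hD hD0 hDt).ne_bot,
          (hf 1 2 (by norm_num) (by norm_num) D hD hD0 hDt).ne_top⟩
      · exact ⟨(hf 1 2 (by norm_num) (by norm_num) D hD hD0 hDt).ne_bot,
          (hf (1 / 2) 1 (by norm_num) (by norm_num) D hD hD0 hDt).ne_top⟩
    exact ⟨_, (hbs.isSPCDSolution hS hτ hn hm).1⟩
  · refine hbs.not_isSPCDSolution ?_ hτ hn htpos ht0 hm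
    rintro ⟨S, hS⟩
    -- If `S_N` converged, the image of a rectangle of volume `1` at time `1` would have measure
    -- `exp S`, neither `0` nor `∞`.
    obtain ⟨R, hR⟩ := exists_isOrdinaryRectangle oneTwoTwo one_pos
    have hRm := measurableSet_rectangle hR.1
    have hRv := ordinaryLebesgue_rectangle hR
    have hRi := hbs.measure_image hS 1 hRm
    rw [hRv, ENNReal.ofReal_one, mul_one] at hRi
    rcases hflow with hf | hf | hf | hf
    · rw [hf 1 one_pos _ hRm (by simp [hRv]) (by simp [hRv])] at hRi
      exact ofReal_exp_ne_zero _ hRi.symm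
    · rw [hf 1 one_pos _ hRm (by simp [hRv]) (by simp [hRv])] at hRi
      exact ENNReal.ofReal_ne_top hRi.symm
    · exact not_tendsto_nhds_of_tendsto_atBot ((hiff _).1 hf) S hS
    · exact not_tendsto_nhds_of_tendsto_atTop ((hiff _).1 hf) S hS
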